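/- Let $0<\alpha<1$, let $E\subseteq\mathbb R^2$ be open with $0\in E$, and let $f\in C^1(E,\mathbb R^2)$ with $f(0)=0$. Consider the planar fractional system $${}_0^C D_t^\alpha X=f(X),\qquad {}_0^C D_t^\alpha x(t)=\frac1{\Gamma(1-\alpha)}\int_0^t (t-\tau)^{-\alpha}x'(\tau)\,d\tau ,$$ the Caputo derivative being taken componentwise. A solution on $[0,T)$ is a function $X:[0,T)\to E$ whose components are absolutely continuous on every $[0,b]$ with $b<T$ and which satisfies the equation for every $t\in(0,T)$ (with convergent integrals). A set $S\subseteq E$ is invariant under the solution map $\Phi_t$ if every solution $X$ on some $[0,T)$ with $X(0)\in S$ satisfies $X(t)\in S$ for all $t\in[0,T)$. Let $g\in C^2(E,\mathbb R)$ and $c\in\mathbb R$ be such that $\nabla g\neq 0$ on the curve $S=\{p\in E: g(p)=c\}$. Then: 1. If $S$ contains a point at which $f\neq 0$ and at which the curvature $$\kappa=\frac{\left|g_{xx}g_y^2-2g_{xy}g_xg_y+g_{yy}g_x^2\right|}{(g_x^2+g_y^2)^{3/2}}$$ of $S$ is positive, then $S$ is not invariant under $\Phi_t$. (In particular, a curve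 $g=c$ whose curvature is positive everywhere and which does not consist entirely of equilibria is not invariant.) 2. If $S$ is nonempty and connected, is not contained in a straight line, and the points of $S$ at which $f\ne0$ are dense in $S$, then $S$ is not invariant under $\Phi_t$. -/

import Mathlib

noncomputable section

namespace FracDyn

/-- The Euclidean plane. -/
abbrev Plane : Type := EuclideanSpace ℝ (Fin 2)

/-- `HasCaputoDerivAt α x d t`: the Caputo derivative of order `α ∈ (0,1)` with base point `0`
of the scalar function `x` exists at time `t` and equals `d`, i.e.
`d = (1 / Γ(1-α)) ∫₀ᵗ (t-τ)^(-α) x'(τ) dτ`, the integral being convergent. -/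
def HasCaputoDerivAt (α : ℝ) (x : ℝ → ℝ) (d t : ℝ) : Prop :=
  IntervalIntegrable (fun τ => (t - τ) ^ (-α) * deriv x τ) MeasureTheory.volume 0 t ∧
    d = 1 / Real.Gamma (1 - α) * ∫ τ in (0 : ℝ)..t, (t - τ) ^ (-α) * deriv x τ

/-- `X` is a solution on `[0,T)`, with values in `E`, of the fractional system
`ᶜD^α X = f(X)`. The components of `X` are absolutely continuous on compact subintervals, so
that the derivative in the Caputo integral exists almost everywhere and determines `X`. -/
structure IsSolution (α : ℝ) (f : Plane → Plane) (E : Set Plane) (T : ℝ) (X : ℝ → Plane) :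
    Prop where
  mem : ∀ t ∈ Set.Ico 0 T, X t ∈ E
  absCont : ∀ i, ∀ b ∈ Set.Ico 0 T, AbsolutelyContinuousOnInterval (fun t => X t i) 0 b
  eqn : ∀ i, ∀ t ∈ Set.Ioo 0 T, HasCaputoDerivAt α (fun s => X s i) (f (X t) i) t

/-- `S` is invariant under the solution map of `ᶜD^α X = f(X)` on `E`: every solution that
starts on `S` stays on `S` for as long as it exists. -/
def IsInvariant (α : ℝ) (f : Plane → Plane) (E S : Set Plane) : Prop :=
  ∀ (T : ℝ) (X : ℝ → Plane), 0 < T → IsSolution α f E T X → X 0 ∈ S →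
    ∀ t ∈ Set.Ico 0 T, X t ∈ S

/-- The level curve `g(x,y) = c` in `E`. -/
def levelCurve (E : Set Plane) (g : Plane → ℝ) (c : ℝ) : Set Plane :=
  {p | p ∈ E ∧ g p = c}

/-- The partial derivative of `g` with respect to the `i`-th coordinate. -/
def partialD (i : Fin 2) (g : Plane → ℝ) : Plane → ℝ :=
  fun p => fderiv ℝ g p (EuclideanSpace.single i 1)

/-- The curvature at `p` of the level curve of `g` through `p` (where `∇g(p) ≠ 0`):
`|g_xx g_y² - 2 g_xy g_x g_y + g_yy g_x²| / (g_x² + g_y²)^(3/2)`. -/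
def curvature (g : Plane → ℝ) (p : Plane) : ℝ :=
  |partialD 0 (partialD 0 g) p * partialD 1 g p ^ 2
      - 2 * partialD 0 (partialD 1 g) p * partialD 0 g p * partialD 1 g p
      + partialD 1 (partialD 1 g) p * partialD 0 g p ^ 2|
    / Real.sqrt (partialD 0 g p ^ 2 + partialD 1 g p ^ 2) ^ 3

/-- `S` is straight: it lies on a line `a x + b y = k`, `(a,b) ≠ (0,0)`. -/
def LiesOnLine (S : Set Plane) : Prop :=
  ∃ a b k : ℝ, (a ≠ 0 ∨ b ≠ 0) ∧ ∀ p ∈ S, a * p 0 + b * p 1 = k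

end FracDyn

end

/-! In the variable `z = t ^ α` the Caputo system becomes `W z = p + z • ∫ f (W (z * u ^ α)) dμ(u)`,
where `μ` has density `(1-u)^(α-1) / Γ(α)` on `(0,1]` and total mass `m`. A contraction argument
gives a Lipschitz solution `W` near each `p ∈ E`, and inverting the Abel integral shows that `W (t ^
α)` solves the original system (`exists_solution`).

Suppose `S` is invariant. Since `W' 0 = m f(p)`, the first order of `g (W z) = c` makes `f` tangent
to `S` at every point. Write `v = f p`, `B = D²g(p)`. Tangency along `W` turns the linear Taylor
term `Dg(p)(W z - p)` into `-z² m B(v,v) ∫ u^α dμ + o(z²)`, while the quadratic term is `z² m²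
B(v,v) / 2 + o(z²)`. Hence `m (m/2 - ∫ u^α dμ) B(v,v) = 0`. For an ordinary differential equation
(`α = 1`) the bracket vanishes; for `α < 1` it does not (`half_rlMeasure_lt_integral_rpow`), so
`B(v,v) = 0` (`second_fderiv_eq_zero_of_level`). When `v ≠ 0` it spans the tangent line, so the
curvature of `S` at `p` is zero, which gives the first claim.

For the second claim, density and continuity make the curvature vanish on all of `S`. The tangent
line is then locally constant along `S`, hence constant by connectedness, and `S` lies on it. -/

section

open MeasureTheory Set Filter Topology Metric Asymptotics
open scoped NNReal BoundedContinuousFunction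

namespace FracDyn

/-! ### Fixed points of the dilation integral equation -/

section FixedPoint

variable {V Ω : Type*} [NormedAddCommGroup V] [NormedSpace ℝ V] [MeasurableSpace Ω]
  {μ : Measure Ω} [IsFiniteMeasure μ] {κ : Ω → ℝ} {f : V → V} {W : ℝ → V} {x₀ : V} {r : ℝ}
  {C L : ℝ≥0}

omit [NormedSpace ℝ V] in
theorem integrable_comp_dilation (hκ : Measurable κ) (hf : LipschitzOnWith L f (closedBall x₀ r))
    (hW : LipschitzWith C W) (hWr : ∀ z, W z ∈ closedBall x₀ r) (z : ℝ) :
    Integrable (fun ω => f (W (z * κ ω))) μ := by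
  have hcont : Continuous (fun z => f (W z)) :=
    hf.continuousOn.comp_continuous hW.continuous hWr
  have hsm : StronglyMeasurable (fun ω => f (W (z * κ ω))) :=
    hcont.stronglyMeasurable.comp_measurable (hκ.const_mul z)
  refine Integrable.of_bound hsm.aestronglyMeasurable (‖f x₀‖ + L * r) (ae_of_all _ fun ω => ?_)
  have hr : 0 ≤ r := dist_nonneg.trans (mem_closedBall.1 (hWr 0))
  have h1 := hf.dist_le_mul _ (hWr (z * κ ω)) _ (mem_closedBall_self hr)
  have h2 := mem_closedBall.1 (hWr (z * κ ω))
  rw [dist_eq_norm] at h1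
  have h3 := norm_le_norm_add_norm_sub' (f (W (z * κ ω))) (f x₀)
  have h4 : (L : ℝ) * dist (W (z * κ ω)) x₀ ≤ L * r := by gcongr
  linarith

/-- Banach's fixed point theorem on the closed set of `C`-Lipschitz maps into the ball, with sup
distance. Because `0 ≤ κ ≤ 1`, dilating the argument by `κ` does not increase Lipschitz constants,
so this set is preserved. -/
theorem exists_lipschitz_dilation_solution [CompleteSpace V] (hκ : Measurable κ)
    (hκ01 : ∀ᵐ ω ∂μ, κ ω ∈ Icc (0 : ℝ) 1) (hr : 0 < r)
    (hf : LipschitzOnWith L f (closedBall x₀ r)) :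
    ∃ δ > 0, ∃ C : ℝ≥0, ∃ W : ℝ → V, LipschitzWith C W ∧ (∀ z, W z ∈ closedBall x₀ r) ∧
      ∀ z ∈ Icc 0 δ, W z = x₀ + z • ∫ ω, f (W (z * κ ω)) ∂μ := by
  set m : ℝ := μ.real univ
  have hm : 0 ≤ m := measureReal_nonneg
  set M : ℝ := ‖f x₀‖ + L * r
  have hM : 0 ≤ M := by positivity
  -- Varying the prefactor costs `M * m` and varying the integrand at most `C / 2`; `C = 2 * M * m`
  -- makes the sum equal to `C`.
  set C : ℝ≥0 := ⟨2 * M * m, by positivity⟩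
  have hC : (C : ℝ) = 2 * M * m := rfl
  -- The first bound keeps the image in the ball; the second gives both the contraction factor and
  -- the `C / 2` above.
  obtain ⟨δ, hδ, hδ1, hδ2⟩ : ∃ δ > 0, δ * (M * m) ≤ r ∧ δ * (L * m) ≤ 1 / 2 := by
    refine ⟨min (r / (M * m + 1)) ((1 / 2) / (L * m + 1)), by positivity, ?_, ?_⟩
    · calc _ ≤ r / (M * m + 1) * (M * m + 1) := by
            gcongr
            · exact min_le_left _ _
            · linarith
        _ = r := by field_simp
    · calc _ ≤ (1 / 2) / (L * m + 1) * (L * m + 1) := by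
            gcongr
            · exact min_le_right _ _
            · linarith
        _ = 1 / 2 := by field_simp
  -- Clamping to `[0, δ]` allows work with bounded functions on all of `ℝ`; the equation is
  -- recovered where the clamp is the identity.
  let cl : ℝ → ℝ := fun z => max 0 (min z δ)
  have hcl0 : ∀ z, 0 ≤ cl z := fun z => le_max_left _ _
  have hcl1 : ∀ z, cl z ≤ δ := fun z => max_le hδ.le (min_le_right _ _)
  have hclL : ∀ z z', |cl z - cl z'| ≤ |z - z'| := fun z z' => by
    simpa [Real.dist_eq] using
      ((LipschitzWith.id.min_const δ).const_max (0 : ℝ)).dist_le_mul z z'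
  have hclid : ∀ z ∈ Icc 0 δ, cl z = z := fun z hz => by
    simp only [cl, min_eq_left hz.2, max_eq_right hz.1]
  let s : Set (ℝ →ᵇ V) := {W | LipschitzWith C W ∧ ∀ z, W z ∈ closedBall x₀ r}
  let Φ : (ℝ →ᵇ V) → ℝ → V := fun W z => x₀ + cl z • ∫ ω, f (W (cl z * κ ω)) ∂μ
  have hbd : ∀ y ∈ closedBall x₀ r, ‖f y‖ ≤ M := fun y hy => by
    have h1 := hf.dist_le_mul _ hy _ (mem_closedBall_self hr.le)
    rw [dist_eq_norm] at h1
    have h3 := norm_le_norm_add_norm_sub' (f y) (f x₀)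
    have h4 : (L : ℝ) * dist y x₀ ≤ L * r := by gcongr; exact mem_closedBall.1 hy
    simp only [M]; linarith
  have hint : ∀ W ∈ s, ∀ z, ‖∫ ω, f (W (z * κ ω)) ∂μ‖ ≤ M * m := fun W hW z =>
    norm_integral_le_of_norm_le_const (ae_of_all _ fun ω => hbd _ (hW.2 _))
  have hball : ∀ W ∈ s, ∀ z, Φ W z ∈ closedBall x₀ r := fun W hW z => by
    simp only [Φ, mem_closedBall, dist_self_add_left, norm_smul, Real.norm_eq_abs,
      abs_of_nonneg (hcl0 z)]
    exact (mul_le_mul (hcl1 z) (hint W hW _) (norm_nonneg _) hδ.le).trans hδ1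
  have hlip : ∀ W ∈ s, LipschitzWith C (Φ W) := fun W hW => by
    refine LipschitzWith.of_dist_le_mul fun z z' => ?_
    have e : Φ W z - Φ W z' = (cl z - cl z') • ∫ ω, f (W (cl z * κ ω)) ∂μ +
        cl z' • ∫ ω, (f (W (cl z * κ ω)) - f (W (cl z' * κ ω))) ∂μ := by
      rw [integral_sub (integrable_comp_dilation hκ hf hW.1 hW.2 _)
        (integrable_comp_dilation hκ hf hW.1 hW.2 _)]
      simp only [Φ, sub_smul, smul_sub]; abel
    have h1 : ‖∫ ω, (f (W (cl z * κ ω)) - f (W (cl z' * κ ω))) ∂μ‖ ≤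
        (L * (C * |z - z'|)) * m := by
      refine norm_integral_le_of_norm_le_const ?_
      filter_upwards [hκ01] with ω hω
      rw [← dist_eq_norm]
      refine (hf.dist_le_mul _ (hW.2 _) _ (hW.2 _)).trans ?_
      gcongr
      refine (hW.1.dist_le_mul _ _).trans ?_
      gcongr
      rw [Real.dist_eq, ← sub_mul, abs_mul, abs_of_nonneg hω.1]
      exact (mul_le_of_le_one_right (abs_nonneg _) hω.2).trans (hclL _ _)
    rw [dist_eq_norm, e, Real.dist_eq]
    refine (norm_add_le _ _).trans ?_
    rw [norm_smul, norm_smul, Real.norm_eq_abs, Real.norm_eq_abs, abs_of_nonneg (hcl0 z')]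
    have h2 : |cl z - cl z'| * ‖∫ ω, f (W (cl z * κ ω)) ∂μ‖ ≤ |z - z'| * (M * m) :=
      mul_le_mul (hclL _ _) (hint W hW _) (norm_nonneg _) (abs_nonneg _)
    have h3 : cl z' * ‖∫ ω, (f (W (cl z * κ ω)) - f (W (cl z' * κ ω))) ∂μ‖ ≤
        δ * ((L * (C * |z - z'|)) * m) :=
      mul_le_mul (hcl1 _) h1 (norm_nonneg _) hδ.le
    have h4 : δ * ((L * (C * |z - z'|)) * m) ≤ 1 / 2 * (C * |z - z'|) := by
      calc _ = δ * (L * m) * (C * |z - z'|) := by ring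
        _ ≤ _ := by gcongr
    rw [hC] at *
    linarith
  classical
  let Ψ : (ℝ →ᵇ V) → (ℝ →ᵇ V) := fun W => if hW : W ∈ s then
    BoundedContinuousFunction.ofNormedAddCommGroup (Φ W) (hlip W hW).continuous (‖x₀‖ + r)
      fun z => by
        have := mem_closedBall.1 (hball W hW z)
        rw [dist_eq_norm] at this
        have h3 := norm_le_norm_add_norm_sub' (Φ W z) x₀
        linarith
    else W
  have hΨ : ∀ W ∈ s, ∀ z, Ψ W z = Φ W z := fun W hW z => by simp [Ψ, hW]
  have hmaps : MapsTo Ψ s s := fun W hW =>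
    ⟨by rw [show ⇑(Ψ W) = Φ W from funext (hΨ W hW)]; exact hlip W hW,
      fun z => by rw [hΨ W hW]; exact hball W hW z⟩
  have hclosed : IsClosed s := by
    have : s = (⋂ z, ⋂ z', {W : ℝ →ᵇ V | dist (W z) (W z') ≤ C * dist z z'}) ∩
        ⋂ z, {W : ℝ →ᵇ V | W z ∈ closedBall x₀ r} := by
      ext W
      simp [s, lipschitzWith_iff_dist_le_mul]
    rw [this]
    refine IsClosed.inter (isClosed_iInter fun z => isClosed_iInter fun z' => ?_)
      (isClosed_iInter fun z => ?_)
    · exact isClosed_le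
        ((continuous_eval_const z).dist
          (continuous_eval_const z')) continuous_const
    · exact isClosed_closedBall.preimage (continuous_eval_const z)
  have hcontr : ContractingWith (1 / 2 : ℝ≥0) (hmaps.restrict Ψ s s) := by
    refine ⟨by rw [← NNReal.coe_lt_coe]; norm_num, LipschitzWith.of_dist_le_mul ?_⟩
    rintro ⟨W, hW⟩ ⟨W', hW'⟩
    simp only [Subtype.dist_eq, MapsTo.val_restrict_apply]
    refine (BoundedContinuousFunction.dist_le (by positivity)).2 fun z => ?_
    rw [hΨ W hW, hΨ W' hW', dist_eq_norm]
    simp only [Φ]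
    rw [add_sub_add_left_eq_sub, ← smul_sub,
      ← integral_sub (integrable_comp_dilation hκ hf hW.1 hW.2 _)
        (integrable_comp_dilation hκ hf hW'.1 hW'.2 _), norm_smul, Real.norm_eq_abs,
        abs_of_nonneg (hcl0 z)]
    have h1 : ‖∫ ω, (f (W (cl z * κ ω)) - f (W' (cl z * κ ω))) ∂μ‖ ≤ (L * dist W W') * m := by
      refine norm_integral_le_of_norm_le_const (ae_of_all _ fun ω => ?_)
      rw [← dist_eq_norm]
      refine (hf.dist_le_mul _ (hW.2 _) _ (hW'.2 _)).trans ?_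
      gcongr
      exact BoundedContinuousFunction.dist_coe_le_dist _
    calc _ ≤ δ * ((L * dist W W') * m) := mul_le_mul (hcl1 _) h1 (norm_nonneg _) hδ.le
      _ = δ * (L * m) * dist W W' := by ring
      _ ≤ _ := by push_cast; gcongr
  obtain ⟨W, hW, hfix, -⟩ := hcontr.exists_fixedPoint' hclosed.isComplete hmaps
    (x := BoundedContinuousFunction.const ℝ x₀)
    ⟨by simpa using LipschitzWith.const' x₀, fun z => by simpa using hr.le⟩ (edist_ne_top _ _)
  refine ⟨δ, hδ, C, W, hW.1, hW.2, fun z hz => ?_⟩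
  have h := congrArg (fun U : ℝ →ᵇ V => U z) hfix
  simp only [hΨ W hW, Φ, hclid z hz] at h
  exact h.symm

end FixedPoint

/-! ### Fubini for iterated convolutions -/

section Convolution

variable {a b h c : ℝ → ℝ} {t K : ℝ}

/-- Iterated convolution on `[0,t]`, by Fubini: `a * (b * h) = (a * b) * h`, where `c s` is the
value at `t - s` of the convolution of the nonnegative kernels `a` and `b`. -/
theorem iterated_convolution (ht : 0 ≤ t) (ha : Measurable a) (hb : Measurable b)
    (hh : Measurable h) (hhi : IntervalIntegrable h volume 0 t)
    (ha0 : ∀ x, 0 ≤ x → 0 ≤ a x) (hb0 : ∀ x, 0 ≤ x → 0 ≤ b x)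
    (hab : ∀ s ∈ Ioo 0 t, IntervalIntegrable (fun τ => a (t - τ) * b (τ - s)) volume s t)
    (hc : ∀ s ∈ Ioo 0 t, ∫ τ in s..t, a (t - τ) * b (τ - s) = c s)
    (hcK : ∀ s ∈ Ioo 0 t, c s ≤ K) :
    IntervalIntegrable (fun τ => a (t - τ) * ∫ s in (0 : ℝ)..τ, b (τ - s) * h s) volume 0 t ∧
    ∫ τ in (0 : ℝ)..t, a (t - τ) * ∫ s in (0 : ℝ)..τ, b (τ - s) * h s
      = ∫ s in (0 : ℝ)..t, c s * h s := by
  set ν := volume.restrict (Ioc 0 t) with hν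
  -- Extension by zero from the triangle `s < τ` to the square; integrating `‖G‖` in `τ` first
  -- leaves `c s * ‖h s‖ ≤ K * ‖h s‖`, which is integrable.
  let G : ℝ → ℝ → ℝ := fun τ s => if s < τ then a (t - τ) * b (τ - s) * h s else 0
  have hGm : Measurable (Function.uncurry G) := by
    refine Measurable.ite (measurableSet_lt measurable_snd measurable_fst) ?_ measurable_const
    exact ((ha.comp (measurable_const.sub measurable_fst)).mul
      (hb.comp (measurable_fst.sub measurable_snd))).mul (hh.comp measurable_snd)
  have hsec : ∀ s ∈ Ioc 0 t, ∀ H : ℝ → ℝ,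
      ∫ τ, (if s < τ then H τ else 0) ∂ν = ∫ τ in s..t, H τ := fun s hs H => by
    rw [intervalIntegral.integral_of_le hs.2, hν]
    have : (fun τ => if s < τ then H τ else 0) = (Ioi s).indicator H := by
      ext τ; simp [indicator]
    rw [this, setIntegral_indicator measurableSet_Ioi]
    congr 2
    ext τ; simp only [mem_inter_iff, mem_Ioc, mem_Ioi]
    constructor
    · rintro ⟨⟨h1, h2⟩, h3⟩; exact ⟨h3, h2⟩
    · rintro ⟨h1, h2⟩; exact ⟨⟨hs.1.trans h1, h2⟩, h1⟩
  have hmem : ∀ᵐ s ∂ν, s ∈ Ioc 0 t := ae_restrict_mem measurableSet_Ioc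
  have hmem' : ∀ᵐ s ∂ν, s ∈ Ioo 0 t := by
    rw [hν, ← Measure.restrict_congr_set Ioo_ae_eq_Ioc]
    exact ae_restrict_mem measurableSet_Ioo
  have hcnn : ∀ s ∈ Ioo 0 t, 0 ≤ c s := fun s hs => by
    rw [← hc s hs]
    exact intervalIntegral.integral_nonneg hs.2.le fun τ hτ =>
      mul_nonneg (ha0 _ (sub_nonneg.2 hτ.2)) (hb0 _ (sub_nonneg.2 hτ.1))
  have hnorm : ∀ s ∈ Ioo 0 t, ∫ τ, ‖G τ s‖ ∂ν = c s * ‖h s‖ := fun s hs => by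
    have e : (fun τ => ‖G τ s‖) =ᵐ[ν]
        fun τ => if s < τ then a (t - τ) * b (τ - s) * ‖h s‖ else 0 := by
      filter_upwards [hmem] with τ hτ
      simp only [G]
      split_ifs with hlt
      · rw [norm_mul, Real.norm_of_nonneg]
        exact mul_nonneg (ha0 _ (sub_nonneg.2 hτ.2)) (hb0 _ (sub_nonneg.2 hlt.le))
      · simp
    rw [integral_congr_ae e, hsec s (Ioo_subset_Ioc_self hs),
      intervalIntegral.integral_mul_const, hc s hs]
  have hhν : Integrable h ν := (intervalIntegrable_iff_integrableOn_Ioc_of_le ht).1 hhi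
  have hGi : Integrable (Function.uncurry G) (ν.prod ν) := by
    rw [integrable_prod_iff' hGm.aestronglyMeasurable]
    constructor
    · filter_upwards [hmem'] with s hs
      have h1 := ((intervalIntegrable_iff_integrableOn_Ioc_of_le hs.2.le).1 (hab s hs)).mul_const
        (h s)
      have h2 : (fun τ => Function.uncurry G (τ, s)) =
          (Ioi s).indicator (fun τ => a (t - τ) * b (τ - s) * h s) := by
        ext τ; simp [indicator, G]
      rw [h2, integrable_indicator_iff measurableSet_Ioi, IntegrableOn, hν,
        Measure.restrict_restrict measurableSet_Ioi]
      exact IntegrableOn.mono_set h1 (fun τ hτ => ⟨hτ.1, hτ.2.2⟩)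
    · refine Integrable.mono' (g := fun s => K * ‖h s‖) (hhν.norm.const_mul K) ?_ ?_
      · exact (hGm.norm.stronglyMeasurable.integral_prod_left').aestronglyMeasurable
      · filter_upwards [hmem'] with s hs
        simp only [Function.uncurry_apply_pair]
        rw [hnorm s hs, Real.norm_of_nonneg (mul_nonneg (hcnn s hs) (norm_nonneg _))]
        exact mul_le_mul_of_nonneg_right (hcK s hs) (norm_nonneg _)
  have hleft : ∀ τ ∈ Ioc 0 t, ∫ s, G τ s ∂ν = a (t - τ) * ∫ s in (0 : ℝ)..τ, b (τ - s) * h s :=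
    fun τ hτ => by
    have h2 : (fun s => G τ s) = (Iio τ).indicator (fun s => a (t - τ) * (b (τ - s) * h s)) := by
      ext s; simp [indicator, G, mul_assoc]
    rw [h2, hν, setIntegral_indicator measurableSet_Iio, ← intervalIntegral.integral_const_mul,
      intervalIntegral.integral_of_le hτ.1.le, integral_Ioc_eq_integral_Ioo]
    congr 2
    ext s; simp only [mem_inter_iff, mem_Ioc, mem_Iio, mem_Ioo]
    constructor
    · rintro ⟨⟨h1, h2⟩, h3⟩; exact ⟨h1, h3⟩
    · rintro ⟨h1, h2⟩; exact ⟨⟨h1, h2.le.trans hτ.2⟩, h2⟩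
  have hright : ∀ s ∈ Ioo 0 t, ∫ τ, G τ s ∂ν = c s * h s := fun s hs => by
    simp only [G]
    rw [hsec s (Ioo_subset_Ioc_self hs), intervalIntegral.integral_mul_const, hc s hs]
  constructor
  · rw [intervalIntegrable_iff_integrableOn_Ioc_of_le ht]
    exact hGi.integral_prod_left.congr
      ((ae_restrict_iff' measurableSet_Ioc).2 (ae_of_all _ fun τ hτ => hleft τ hτ))
  · rw [intervalIntegral.integral_of_le ht, intervalIntegral.integral_of_le ht]
    rw [← setIntegral_congr_fun measurableSet_Ioc hleft,
      ← integral_congr_ae (hmem'.mono hright)]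
    exact integral_integral_swap hGi

end Convolution

/-! ### Power kernels and the Beta integral -/

section Kernels

variable {α s t : ℝ}

theorem intervalIntegrable_sub_rpow (hα : 0 < α) :
    IntervalIntegrable (fun τ => (t - τ) ^ (α - 1)) volume s t := by
  simpa using ((intervalIntegral.intervalIntegrable_rpow' (a := 0) (b := t - s) (r := α - 1)
    (by linarith)).comp_sub_left t).symm

theorem intervalIntegrable_rpow_sub (hα : 0 < α) :
    IntervalIntegrable (fun τ => (τ - s) ^ (α - 1)) volume s t := by
  simpa using (intervalIntegral.intervalIntegrable_rpow' (a := 0) (b := t - s) (r := α - 1)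
    (by linarith)).comp_sub_right s

theorem integral_sub_rpow (hα : 0 < α) :
    ∫ τ in s..t, (t - τ) ^ (α - 1) = (t - s) ^ α / α := by
  rw [intervalIntegral.integral_comp_sub_left (fun x => x ^ (α - 1)), sub_self,
    integral_rpow (Or.inl (by linarith))]
  simp [Real.zero_rpow hα.ne']

theorem integral_rpow_sub (hα : 0 < α) :
    ∫ τ in s..t, (τ - s) ^ (α - 1) = (t - s) ^ α / α := by
  rw [intervalIntegral.integral_comp_sub_right (fun x => x ^ (α - 1)), sub_self,
    integral_rpow (Or.inl (by linarith))]
  simp [Real.zero_rpow hα.ne']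

/-- The integrand is homogeneous of degree `-1`, so rescaling to `r = 1` removes `r` and leaves the
Beta integral `B(α, 1-α)`. -/
theorem abel_kernel_aux (hα0 : 0 < α) (hα1 : α < 1) {r : ℝ} (hr : 0 < r) :
    IntervalIntegrable (fun τ => (r - τ) ^ (-α) * τ ^ (α - 1)) volume 0 r ∧
    ∫ τ in (0 : ℝ)..r, (r - τ) ^ (-α) * τ ^ (α - 1) = Real.Gamma α * Real.Gamma (1 - α) := by
  have hu : 0 < (α : ℂ).re := by simpa
  have hv : 0 < (1 - α : ℂ).re := by simpa
  have e : ∀ r : ℝ, ∀ τ ∈ Ioc 0 r, (((r - τ) ^ (-α) * τ ^ (α - 1) : ℝ) : ℂ)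
      = (τ : ℂ) ^ ((α : ℂ) - 1) * ((r : ℂ) - τ) ^ ((1 - α : ℂ) - 1) := fun r τ hτ => by
    rw [Complex.ofReal_mul, Complex.ofReal_cpow (sub_nonneg.2 hτ.2),
      Complex.ofReal_cpow hτ.1.le]
    push_cast
    rw [mul_comm]
    congr 2
    ring
  have hint1 : IntervalIntegrable (fun τ : ℝ => (1 - τ) ^ (-α) * τ ^ (α - 1)) volume 0 1 := by
    have h1 := Complex.betaIntegral_convergent hu hv
    rw [intervalIntegrable_iff_integrableOn_Ioc_of_le zero_le_one] at h1 ⊢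
    have h2 := Integrable.re h1
    refine IntegrableOn.congr_fun h2 (fun τ hτ => ?_) measurableSet_Ioc
    rw [← RCLike.ofReal_re (K := ℂ) ((1 - τ) ^ (-α) * τ ^ (α - 1))]
    congr 1
    have := e 1 τ hτ
    simp only [Complex.ofReal_one] at this
    exact this.symm
  constructor
  · have h3 := (hint1.comp_mul_left (c := r⁻¹)).const_mul (r⁻¹)
    simp only [zero_mul, div_inv_eq_mul, one_mul] at h3
    rw [intervalIntegrable_iff_integrableOn_Ioc_of_le hr.le] at h3 ⊢
    refine IntegrableOn.congr_fun h3 (fun τ hτ => ?_) measurableSet_Ioc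
    rw [show 1 - r⁻¹ * τ = r⁻¹ * (r - τ) by field_simp,
      Real.mul_rpow (by positivity) (sub_nonneg.2 hτ.2), Real.mul_rpow (by positivity) hτ.1.le]
    have : r⁻¹ * (r⁻¹ ^ (-α) * r⁻¹ ^ (α - 1)) = 1 := by
      rw [← Real.rpow_add (by positivity), show -α + (α - 1) = -1 by ring, Real.rpow_neg_one]
      field_simp
    linear_combination ((r - τ) ^ (-α) * τ ^ (α - 1)) * this
  · have h4 := Complex.betaIntegral_scaled α (1 - α) hr
    have h5 := Complex.Gamma_mul_Gamma_eq_betaIntegral hu hv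
    rw [show (α : ℂ) + (1 - α) = 1 by ring] at h4 h5
    rw [Complex.Gamma_one, one_mul] at h5
    rw [sub_self, Complex.cpow_zero, one_mul, ← h5] at h4
    rw [← Complex.ofReal_inj, ← intervalIntegral.integral_ofReal, Complex.ofReal_mul,
      ← Complex.Gamma_ofReal, ← Complex.Gamma_ofReal]
    push_cast
    rw [← h4, intervalIntegral.integral_of_le hr.le, intervalIntegral.integral_of_le hr.le]
    refine setIntegral_congr_fun measurableSet_Ioc fun τ hτ => ?_
    have := e r τ hτ
    push_cast at this
    simpa using this

theorem intervalIntegrable_abel_kernel (hα0 : 0 < α) (hα1 : α < 1) (hst : s < t) :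
    IntervalIntegrable (fun τ => (t - τ) ^ (-α) * (τ - s) ^ (α - 1)) volume s t := by
  simpa using (abel_kernel_aux hα0 hα1 (sub_pos.2 hst)).1.comp_sub_right s

theorem integral_abel_kernel (hα0 : 0 < α) (hα1 : α < 1) (hst : s < t) :
    ∫ τ in s..t, (t - τ) ^ (-α) * (τ - s) ^ (α - 1) = Real.Gamma α * Real.Gamma (1 - α) := by
  rw [← (abel_kernel_aux hα0 hα1 (sub_pos.2 hst)).2]
  have := intervalIntegral.integral_comp_sub_right (a := s) (b := t)
    (fun x => ((t - s) - x) ^ (-α) * x ^ (α - 1)) s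
  simpa using this

end Kernels

end FracDyn

/-! ### Absolute continuity and inversion of the Abel integral -/

theorem AbsolutelyContinuousOnInterval.congr_of_eqOn {x y : ℝ → ℝ} {a b : ℝ}
    (hx : AbsolutelyContinuousOnInterval x a b) (h : EqOn x y (uIcc a b)) :
    AbsolutelyContinuousOnInterval y a b := by
  rw [absolutelyContinuousOnInterval_iff] at hx ⊢
  intro ε hε
  obtain ⟨δ, hδ, H⟩ := hx ε hε
  refine ⟨δ, hδ, fun I hI hlt => ?_⟩
  rw [Finset.sum_congr rfl fun i hi => by rw [← h (hI.1 i hi).1, ← h (hI.1 i hi).2]]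
  exact H I hI hlt

theorem LipschitzWith.comp_absolutelyContinuousOnInterval {Y Z : Type*} [PseudoMetricSpace Y]
    [PseudoMetricSpace Z] {φ : Y → Z} {K : ℝ≥0} {x : ℝ → Y} {a b : ℝ} (hφ : LipschitzWith K φ)
    (hx : AbsolutelyContinuousOnInterval x a b) :
    AbsolutelyContinuousOnInterval (fun t => φ (x t)) a b := by
  unfold AbsolutelyContinuousOnInterval at hx ⊢
  have h := Tendsto.const_mul (K : ℝ) hx
  rw [mul_zero] at h
  refine squeeze_zero (fun _ => Finset.sum_nonneg fun _ _ => dist_nonneg) (fun I => ?_) h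
  rw [Finset.mul_sum]
  exact Finset.sum_le_sum fun i _ => hφ.dist_le_mul _ _

theorem absolutelyContinuousOnInterval_rpow {α b : ℝ} (hα : 0 < α) :
    AbsolutelyContinuousOnInterval (fun t => t ^ α) 0 b := by
  have h := ((intervalIntegral.intervalIntegrable_rpow' (a := 0) (b := b) (r := α - 1)
    (by linarith)).absolutelyContinuousOnInterval_intervalIntegral left_mem_uIcc).const_mul α
  refine h.congr_of_eqOn fun t _ => ?_
  simp only
  rw [integral_rpow (Or.inl (by linarith)), sub_add_cancel, Real.zero_rpow hα.ne']
  field_simp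
  simp

namespace FracDyn

/-- A solution `x = x₀ + I^α F` of the Abel equation with absolutely continuous `F` is absolutely
continuous, and its Caputo derivative at the endpoint is `F`. -/
theorem hasCaputoDerivAt_of_abel {α : ℝ} (hα0 : 0 < α) (hα1 : α < 1) {F x : ℝ → ℝ} {x₀ t : ℝ}
    (ht : 0 < t) (hF : AbsolutelyContinuousOnInterval F 0 t)
    (hx : ∀ s ∈ Icc 0 t,
      x s = x₀ + 1 / Real.Gamma α * ∫ τ in (0 : ℝ)..s, (s - τ) ^ (α - 1) * F τ) :
    AbsolutelyContinuousOnInterval x 0 t ∧ HasCaputoDerivAt α x (F t) t := by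
  have hΓ : 0 < Real.Gamma α := Real.Gamma_pos_of_pos hα0
  have hΓ' : 0 < Real.Gamma (1 - α) := Real.Gamma_pos_of_pos (by linarith)
  set h := deriv F with hh
  have hhm : Measurable h := measurable_deriv F
  have hsub : ∀ s ∈ Icc 0 t, uIcc 0 s ⊆ uIcc 0 t := fun s hs => by
    rw [uIcc_of_le hs.1, uIcc_of_le ht.le]; exact Icc_subset_Icc_right hs.2
  have hhi : ∀ s ∈ Icc 0 t, IntervalIntegrable h volume 0 s := fun s hs =>
    (hF.mono (hsub s hs)).intervalIntegrable_deriv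
  have hFs : ∀ s ∈ Icc 0 t, F s = F 0 + ∫ τ in (0 : ℝ)..s, h τ := fun s hs => by
    rw [(hF.mono (hsub s hs)).integral_deriv_eq_sub]; ring
  have hbm : ∀ β : ℝ, Measurable fun u : ℝ => u ^ β := fun β => by fun_prop
  -- `hA` and `hB` convolve `h` with `1` and `u ^ (α - 1)` in the two orders. Both give the kernel
  -- `(s - σ) ^ α / α`, so the orders agree.
  have hA : ∀ s ∈ Icc 0 t, _ := fun s hs =>
    iterated_convolution (a := fun _ => 1) (b := fun u => u ^ (α - 1)) (h := h)
      (c := fun σ => (s - σ) ^ α / α) (K := s ^ α / α) hs.1 measurable_const (hbm _) hhm (hhi s hs)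
      (fun _ _ => zero_le_one) (fun u hu => Real.rpow_nonneg hu _)
      (fun σ _ => by simpa using intervalIntegrable_rpow_sub hα0)
      (fun σ _ => by simpa using integral_rpow_sub hα0)
      (fun σ hσ => by
        have := hσ.1.le
        have := hσ.2.le
        gcongr
        linarith)
  have hB : ∀ s ∈ Icc 0 t, _ := fun s hs =>
    iterated_convolution (a := fun u => u ^ (α - 1)) (b := fun _ => 1) (h := h)
      (c := fun σ => (s - σ) ^ α / α) (K := s ^ α / α) hs.1 (hbm _) measurable_const hhm (hhi s hs)
      (fun u hu => Real.rpow_nonneg hu _) (fun _ _ => zero_le_one)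
      (fun σ _ => by simpa using intervalIntegrable_sub_rpow hα0)
      (fun σ _ => by simpa using integral_sub_rpow hα0)
      (fun σ hσ => by
        have := hσ.1.le
        have := hσ.2.le
        gcongr
        linarith)
  -- Here the combined kernel is constant, so the Caputo integral collapses to `∫ h`.
  have hC := iterated_convolution (a := fun u => u ^ (-α)) (b := fun u => u ^ (α - 1)) (h := h)
      (c := fun _ => Real.Gamma α * Real.Gamma (1 - α)) (K := Real.Gamma α * Real.Gamma (1 - α))
      ht.le (hbm _) (hbm _) hhm (hhi t ⟨ht.le, le_rfl⟩)
      (fun u hu => Real.rpow_nonneg hu _) (fun u hu => Real.rpow_nonneg hu _)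
      (fun σ hσ => intervalIntegrable_abel_kernel hα0 hα1 hσ.2)
      (fun σ hσ => integral_abel_kernel hα0 hα1 hσ.2) (fun _ _ => le_rfl)
  simp only [one_mul] at hA hB
  -- The expected derivative of `x`, found by inserting `F = F 0 + ∫ h` into the Abel integral and
  -- differentiating formally.
  let y : ℝ → ℝ := fun τ =>
    1 / Real.Gamma α * (F 0 * τ ^ (α - 1) + ∫ s in (0 : ℝ)..τ, (τ - s) ^ (α - 1) * h s)
  have hpow : ∀ s, IntervalIntegrable (fun τ : ℝ => F 0 * τ ^ (α - 1)) volume 0 s := fun s =>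
    (intervalIntegral.intervalIntegrable_rpow' (by linarith)).const_mul _
  have hyi : ∀ s ∈ Icc 0 t, IntervalIntegrable y volume 0 s := fun s hs =>
    ((hpow s).add (hA s hs).1).const_mul _
  have hxy : ∀ s ∈ Icc 0 t, x s = x₀ + ∫ τ in (0 : ℝ)..s, y τ := fun s hs => by
    rw [hx s hs]
    congr 1
    simp only [y]
    rw [intervalIntegral.integral_const_mul, intervalIntegral.integral_add (hpow s) (hA s hs).1,
      (hA s hs).2, ← (hB s hs).2, intervalIntegral.integral_const_mul]
    congr 1
    have e1 := integral_sub_rpow (s := 0) (t := s) hα0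
    have e2 := integral_rpow_sub (s := 0) (t := s) hα0
    simp only [sub_zero] at e1 e2
    rw [e2, ← e1, mul_comm, ← intervalIntegral.integral_mul_const, ← intervalIntegral.integral_add
      ((intervalIntegrable_sub_rpow hα0).mul_const _) (hB s hs).1]
    refine intervalIntegral.integral_congr fun τ hτ => ?_
    rw [uIcc_of_le hs.1] at hτ
    rw [hFs τ ⟨hτ.1, hτ.2.trans hs.2⟩]
    ring
  have hxAC : AbsolutelyContinuousOnInterval x 0 t := by
    have h1 := (hyi t ⟨ht.le, le_rfl⟩).absolutelyContinuousOnInterval_intervalIntegral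
      (left_mem_uIcc)
    have h2 : AbsolutelyContinuousOnInterval (fun _ : ℝ => x₀) 0 t :=
      (LipschitzWith.const x₀).lipschitzOnWith.absolutelyContinuousOnInterval
    refine (h2.add h1).congr_of_eqOn fun s hs => ?_
    rw [uIcc_of_le ht.le] at hs
    exact (hxy s hs).symm
  have hderiv : ∀ᵐ τ, τ ∈ Ioo 0 t → deriv x τ = y τ := by
    filter_upwards [(hyi t ⟨ht.le, le_rfl⟩).ae_hasDerivAt_integral] with τ hτ hτt
    have h1 := hτ (by rw [uIcc_of_le ht.le]; exact Ioo_subset_Icc_self hτt) 0 left_mem_uIcc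
    refine ((h1.const_add x₀).congr_of_eventuallyEq ?_).deriv
    filter_upwards [isOpen_Ioo.mem_nhds hτt] with s hs
    exact hxy s (Ioo_subset_Icc_self hs)
  have hk := abel_kernel_aux hα0 hα1 ht
  have hsum : (fun τ => (t - τ) ^ (-α) * deriv x τ) =ᵐ[volume.restrict (Ioc 0 t)]
      fun τ => 1 / Real.Gamma α * (F 0 * ((t - τ) ^ (-α) * τ ^ (α - 1)) +
        (t - τ) ^ (-α) * ∫ s in (0 : ℝ)..τ, (τ - s) ^ (α - 1) * h s) := by
    rw [← Measure.restrict_congr_set Ioo_ae_eq_Ioc, EventuallyEq,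
      ae_restrict_iff' measurableSet_Ioo]
    filter_upwards [hderiv] with τ hτ hτt
    rw [hτ hτt]
    simp only [y]
    ring
  have hi1 := ((hk.1.const_mul (F 0)).add hC.1).const_mul (1 / Real.Gamma α)
  refine ⟨hxAC, hi1.congr_ae ?_, ?_⟩
  · rw [uIoc_of_le ht.le]; exact hsum.symm
  · rw [intervalIntegral.integral_of_le ht.le, integral_congr_ae hsum,
      ← intervalIntegral.integral_of_le ht.le, intervalIntegral.integral_const_mul,
      intervalIntegral.integral_add (hk.1.const_mul _) hC.1, intervalIntegral.integral_const_mul,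
      hk.2, hC.2, intervalIntegral.integral_const_mul, hFs t ⟨ht.le, le_rfl⟩]
    field_simp

/-! ### The Riemann–Liouville measure and local existence -/

/-- The measure on `(0,1]` with density `(1-u)^(α-1) / Γ(α)`. -/
noncomputable def rlMeasure (α : ℝ) : Measure ℝ :=
  (volume.restrict (Ioc 0 1)).withDensity
    fun u => ENNReal.ofReal ((1 - u) ^ (α - 1) / Real.Gamma α)

section

variable {α : ℝ}

theorem isFiniteMeasure_rlMeasure (hα : 0 < α) : IsFiniteMeasure (rlMeasure α) := by
  refine isFiniteMeasure_withDensity_ofReal (Integrable.hasFiniteIntegral ?_)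
  exact ((intervalIntegrable_iff_integrableOn_Ioc_of_le zero_le_one).1
    (intervalIntegrable_sub_rpow (s := 0) (t := 1) hα)).div_const _

theorem integral_rlMeasure (hα : 0 < α) (φ : ℝ → ℝ) :
    ∫ u, φ u ∂(rlMeasure α)
      = 1 / Real.Gamma α * ∫ u in (0 : ℝ)..1, (1 - u) ^ (α - 1) * φ u := by
  have hΓ : 0 < Real.Gamma α := Real.Gamma_pos_of_pos hα
  rw [rlMeasure, integral_withDensity_eq_integral_toReal_smul (by fun_prop) (by simp),
    intervalIntegral.integral_of_le zero_le_one, ← integral_const_mul]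
  refine setIntegral_congr_fun measurableSet_Ioc fun u hu => ?_
  simp only [smul_eq_mul]
  rw [ENNReal.toReal_ofReal (div_nonneg (Real.rpow_nonneg (sub_nonneg.2 hu.2) _) hΓ.le)]
  ring

theorem rlMeasure_ae_mem (α : ℝ) : ∀ᵐ u ∂(rlMeasure α), u ∈ Ioc (0 : ℝ) 1 :=
  (withDensity_absolutelyContinuous _ _).ae_le (ae_restrict_mem measurableSet_Ioc)

theorem rlMeasure_ae_rpow_mem (hα : 0 < α) :
    ∀ᵐ u ∂(rlMeasure α), u ^ α ∈ Icc (0 : ℝ) 1 := by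
  filter_upwards [rlMeasure_ae_mem α] with u hu
  exact ⟨Real.rpow_nonneg hu.1.le _, Real.rpow_le_one hu.1.le hu.2 hα.le⟩

theorem rlMeasure_real_univ (hα : 0 < α) :
    (rlMeasure α).real univ = 1 / (α * Real.Gamma α) := by
  have h := integral_rlMeasure hα fun _ => 1
  have e := integral_sub_rpow (s := 0) (t := 1) hα
  simp only [sub_zero, Real.one_rpow] at e
  simp only [integral_const, smul_eq_mul, mul_one, e] at h
  rw [h]
  field_simp

/-- Since `u ≤ u ^ α` on `(0,1)`, the right side is at least `1 / (Γ(α) α (α + 1))`, and `α + 1 <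
2`. At `α = 1` the two sides coincide: this is where fractional order differs from an ordinary
differential equation. -/
theorem half_rlMeasure_lt_integral_rpow (hα0 : 0 < α) (hα1 : α < 1) :
    (rlMeasure α).real univ / 2 < ∫ u, u ^ α ∂(rlMeasure α) := by
  have hΓ : 0 < Real.Gamma α := Real.Gamma_pos_of_pos hα0
  rw [rlMeasure_real_univ hα0, integral_rlMeasure hα0]
  have i1 := intervalIntegrable_sub_rpow (s := 0) (t := 1) hα0
  have i2 := intervalIntegrable_sub_rpow (s := 0) (t := 1) (α := α + 1) (by linarith)
  have e1 := integral_sub_rpow (s := 0) (t := 1) hα0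
  have e2 := integral_sub_rpow (s := 0) (t := 1) (α := α + 1) (by linarith)
  simp only [sub_zero, Real.one_rpow] at e1 e2
  have h1 : ∫ u in (0 : ℝ)..1, ((1 - u) ^ (α - 1) - (1 - u) ^ (α + 1 - 1))
      ≤ ∫ u in (0 : ℝ)..1, (1 - u) ^ (α - 1) * u ^ α := by
    refine intervalIntegral.integral_mono_on_of_le_Ioo zero_le_one (i1.sub i2)
      (i1.mul_continuousOn (Real.continuous_rpow_const hα0.le).continuousOn) fun u hu => ?_
    have h2 : u ≤ u ^ α := by
      simpa using Real.rpow_le_rpow_of_exponent_ge hu.1 hu.2.le hα1.le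
    have h3 : 0 < 1 - u := by linarith [hu.2]
    rw [show α + 1 - 1 = α - 1 + 1 by ring, Real.rpow_add_one h3.ne']
    have h4 := mul_le_mul_of_nonneg_left h2 (Real.rpow_nonneg h3.le (α - 1))
    linarith
  rw [intervalIntegral.integral_sub i1 i2, e1, e2] at h1
  have h5 : 1 / (2 * α) < 1 / α - 1 / (α + 1) := by
    rw [div_sub_div _ _ hα0.ne' (by linarith), div_lt_div_iff₀ (by positivity) (by positivity)]
    nlinarith
  calc 1 / (α * Real.Gamma α) / 2 = 1 / Real.Gamma α * (1 / (2 * α)) := by field_simp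
    _ < 1 / Real.Gamma α * (1 / α - 1 / (α + 1)) := by gcongr
    _ ≤ _ := by gcongr

end

/-- Local existence, with the solution written as a Lipschitz function of `t ^ α`. -/
theorem exists_solution {α : ℝ} (hα0 : 0 < α) (hα1 : α < 1) {E : Set Plane} (hE : IsOpen E)
    {f : Plane → Plane} (hf : ContDiffOn ℝ 1 f E) {p : Plane} (hp : p ∈ E) :
    ∃ δ > 0, ∃ C : ℝ≥0, ∃ W : ℝ → Plane, ∃ L : ℝ≥0, ∃ r > 0, closedBall p r ⊆ E ∧
      LipschitzOnWith L f (closedBall p r) ∧ LipschitzWith C W ∧ (∀ z, W z ∈ closedBall p r) ∧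
      (∀ z ∈ Icc 0 δ, W z = p + z • ∫ u, f (W (z * u ^ α)) ∂(rlMeasure α)) ∧
      IsSolution α f E (δ ^ (1 / α)) fun t => W (t ^ α) := by
  obtain ⟨L, U, hU, hL⟩ := ((hf.contDiffAt (hE.mem_nhds hp)).of_le
    (le_refl _)).exists_lipschitzOnWith
  obtain ⟨r, hr, hrU⟩ := nhds_basis_closedBall.mem_iff.1 (inter_mem hU (hE.mem_nhds hp))
  have hL' := hL.mono (hrU.trans inter_subset_left)
  have hrE := hrU.trans inter_subset_right
  have := isFiniteMeasure_rlMeasure hα0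
  have hκ : Measurable fun u : ℝ => u ^ α := by fun_prop
  obtain ⟨δ, hδ, C, W, hW, hWr, hWeq⟩ := exists_lipschitz_dilation_solution
    (μ := rlMeasure α) hκ (rlMeasure_ae_rpow_mem hα0) hr hL'
  refine ⟨δ, hδ, C, W, L, r, hr, hrE, hL', hW, hWr, hWeq, ?_⟩
  have hδα : ∀ t ∈ Icc 0 (δ ^ (1 / α)), t ^ α ∈ Icc 0 δ := fun t ht => by
    refine ⟨Real.rpow_nonneg ht.1 _, (Real.rpow_le_rpow ht.1 ht.2 hα0.le).trans_eq ?_⟩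
    rw [← Real.rpow_mul hδ.le, one_div_mul_cancel hα0.ne', Real.rpow_one]
  have hlip : ∀ i, LipschitzWith (L * C) fun z => f (W z) i := fun i => by
    refine LipschitzWith.of_dist_le_mul fun z z' => ?_
    rw [NNReal.coe_mul, mul_assoc, Real.dist_eq]
    calc |f (W z) i - f (W z') i| = ‖(f (W z) - f (W z')) i‖ := by simp
      _ ≤ ‖f (W z) - f (W z')‖ := PiLp.norm_apply_le _ i
      _ = dist (f (W z)) (f (W z')) := (dist_eq_norm _ _).symm
      _ ≤ L * dist (W z) (W z') := hL'.dist_le_mul _ (hWr z) _ (hWr z')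
      _ ≤ L * (C * dist z z') := by gcongr; exact hW.dist_le_mul _ _
  have key : ∀ i, ∀ t, 0 < t → t ≤ δ ^ (1 / α) →
      AbsolutelyContinuousOnInterval (fun t => W (t ^ α) i) 0 t ∧
      HasCaputoDerivAt α (fun s => W (s ^ α) i) (f (W (t ^ α)) i) t := fun i t ht htT => by
    refine hasCaputoDerivAt_of_abel (F := fun s => f (W (s ^ α)) i) (x₀ := p i) hα0 hα1 ht
      ((hlip i).comp_absolutelyContinuousOnInterval (absolutelyContinuousOnInterval_rpow hα0))
      fun s hs => ?_
    rw [hWeq _ (hδα s ⟨hs.1, hs.2.trans htT⟩)]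
    have e1 : (∫ u, f (W (s ^ α * u ^ α)) ∂(rlMeasure α)) i
        = ∫ u, f (W (s ^ α * u ^ α)) i ∂(rlMeasure α) :=
      ((EuclideanSpace.proj i : Plane →L[ℝ] ℝ).integral_comp_comm
        (integrable_comp_dilation hκ hL' hW hWr (s ^ α))).symm
    rw [PiLp.add_apply, PiLp.smul_apply, e1, integral_rlMeasure hα0, smul_eq_mul]
    congr 1
    rcases hs.1.eq_or_lt with rfl | hs0
    · simp [Real.zero_rpow hα0.ne']
    -- The substitution `τ = s * u` produces the factor `s * s ^ (α - 1) = s ^ α`, the prefactor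
    -- `z`.
    have e2 := intervalIntegral.mul_integral_comp_mul_left (a := 0) (b := 1) (c := s)
      (f := fun τ => (s - τ) ^ (α - 1) * f (W (τ ^ α)) i)
    rw [mul_zero, mul_one] at e2
    rw [← e2, mul_left_comm]
    congr 1
    rw [← intervalIntegral.integral_const_mul, ← intervalIntegral.integral_const_mul]
    refine intervalIntegral.integral_congr fun u hu => ?_
    rw [uIcc_of_le zero_le_one] at hu
    simp only
    rw [show s - s * u = s * (1 - u) by ring, Real.mul_rpow hs0.le (sub_nonneg.2 hu.2),
      Real.mul_rpow hs0.le hu.1, Real.rpow_sub_one hs0.ne']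
    field_simp
  refine ⟨fun t _ => hrE (hWr _), fun i b hb => ?_, fun i t ht => (key i t ht.1 ht.2.le).2⟩
  have hT : 0 < δ ^ (1 / α) := by positivity
  refine (key i _ hT le_rfl).1.mono ?_
  rw [uIcc_of_le hb.1, uIcc_of_le hT.le]
  exact Icc_subset_Icc_right hb.2.le

end FracDyn

/-! ### Second-order expansion along a solution -/

/-- By symmetry of the second derivative, the remainder has derivative `Dg(q) - Dg(p) - B(q - p) =
o(‖q - p‖)`; integrating over a convex ball gains one power. -/
theorem ContDiffAt.taylor_two_isLittleO {V : Type*} [NormedAddCommGroup V] [NormedSpace ℝ V]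
    {g : V → ℝ} {p : V} (hg : ContDiffAt ℝ 2 g p) :
    (fun q => g q - g p - fderiv ℝ g p (q - p) -
      1 / 2 * fderiv ℝ (fderiv ℝ g) p (q - p) (q - p)) =o[𝓝 p] fun q => ‖q - p‖ ^ 2 := by
  set B := fderiv ℝ (fderiv ℝ g) p
  have hsymm : ∀ v w, B v w = B w v := hg.isSymmSndFDerivAt (by simp)
  have hB : HasFDerivAt (fderiv ℝ g) B p :=
    ((hg.fderiv_right (m := 1) (by norm_num)).differentiableAt one_ne_zero).hasFDerivAt
  obtain ⟨U, hU, hgU⟩ := (hg.eventually (by simp)).exists_mem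
  obtain ⟨ε, hε, hεU⟩ := Metric.mem_nhds_iff.1 hU
  let R : V → ℝ := fun q => g q - fderiv ℝ g p (q - p) - 1 / 2 * B (q - p) (q - p)
  have hR : ∀ q ∈ ball p ε, HasFDerivWithinAt R (fderiv ℝ g q - fderiv ℝ g p - B (q - p))
      (ball p ε) q := fun q hq => by
    have h1 : HasFDerivAt g (fderiv ℝ g q) q :=
      ((hgU q (hεU hq)).differentiableAt two_ne_zero).hasFDerivAt
    have h2 : HasFDerivAt (fun q : V => q - p) (ContinuousLinearMap.id ℝ V) q :=
      (hasFDerivAt_id q).sub_const p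
    have h3 := (fderiv ℝ g p).hasFDerivAt.comp q h2
    have h4 := ((B.hasFDerivAt.comp q h2).clm_apply h2).const_mul (1 / 2 : ℝ)
    refine (HasFDerivAt.congr_fderiv (f := R) ((h1.sub h3).sub h4) ?_).hasFDerivWithinAt
    ext v
    simp [hsymm v q, hsymm v p]
    ring
  have hlit : (fun q => fderiv ℝ g q - fderiv ℝ g p - B (q - p)) =o[𝓝[ball p ε] p]
      fun q => ‖q - p‖ ^ 1 := by
    simp only [pow_one]
    exact (hasFDerivAt_iff_isLittleO.1 hB).norm_right.mono nhdsWithin_le_nhds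
  have h := (convex_ball p ε).isLittleO_pow_succ (mem_ball_self hε) hR hlit
  rw [nhdsWithin_eq_nhds.2 (ball_mem_nhds p hε)] at h
  refine h.congr_left fun q => ?_
  simp [R]
  ring

namespace FracDyn

section Expansion

variable {V Ω : Type*} [NormedAddCommGroup V] [NormedSpace ℝ V] [MeasurableSpace Ω]
  {μ : Measure Ω} [IsFiniteMeasure μ] {κ : Ω → ℝ} {f : V → V} {W : ℝ → V} {x₀ : V} {r δ : ℝ}
  {C L : ℝ≥0}

/-- The difference quotient at `0` is the integral itself, which is Lipschitz in `z`, so its limit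
is its value at `0`. -/
theorem dilation_solution_hasDerivWithinAt [CompleteSpace V] (hκ : Measurable κ)
    (hκ01 : ∀ᵐ ω ∂μ, κ ω ∈ Icc (0 : ℝ) 1) (hf : LipschitzOnWith L f (closedBall x₀ r))
    (hW : LipschitzWith C W) (hWr : ∀ z, W z ∈ closedBall x₀ r) (hδ : 0 < δ)
    (hWeq : ∀ z ∈ Icc 0 δ, W z = x₀ + z • ∫ ω, f (W (z * κ ω)) ∂μ) :
    HasDerivWithinAt W (μ.real univ • f x₀) (Ici 0) 0 := by
  have hW0 : W 0 = x₀ := by simpa using hWeq 0 ⟨le_rfl, hδ.le⟩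
  let J : ℝ → V := fun z => ∫ ω, f (W (z * κ ω)) ∂μ
  have hJ0 : J 0 = μ.real univ • f x₀ := by simp [J, hW0]
  have hJ : LipschitzWith (L * C * (μ.real univ).toNNReal) J := by
    refine LipschitzWith.of_dist_le_mul fun z z' => ?_
    rw [dist_eq_norm, ← integral_sub (integrable_comp_dilation hκ hf hW hWr _)
      (integrable_comp_dilation hκ hf hW hWr _)]
    refine (norm_integral_le_of_norm_le_const (C := L * (C * dist z z')) ?_).trans_eq ?_
    · filter_upwards [hκ01] with ω hω
      rw [← dist_eq_norm]
      refine (hf.dist_le_mul _ (hWr _) _ (hWr _)).trans ?_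
      gcongr
      refine (hW.dist_le_mul _ _).trans ?_
      gcongr
      rw [Real.dist_eq, ← sub_mul, abs_mul, abs_of_nonneg hω.1]
      exact mul_le_of_le_one_right (abs_nonneg _) hω.2
    · rw [NNReal.coe_mul, NNReal.coe_mul, Real.coe_toNNReal _ measureReal_nonneg]
      ring
  rw [← hasDerivWithinAt_Ioi_iff_Ici, hasDerivWithinAt_iff_tendsto_slope' (by simp), ← hJ0]
  refine (hJ.continuous.continuousWithinAt (s := Ioi 0)).tendsto.congr' ?_
  filter_upwards [Ioc_mem_nhdsGT hδ] with z hz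
  rw [slope_def_module, hWeq z ⟨hz.1.le, hz.2⟩, hW0, add_sub_cancel_left, sub_zero,
    inv_smul_smul₀ hz.1.ne']

/-- As `κ ≤ 1`, replacing `ψ (z * κ)` by its linear part costs `o(z)` uniformly in `ω`. -/
theorem tendsto_inv_mul_integral_dilation (hκ : Measurable κ)
    (hκ01 : ∀ᵐ ω ∂μ, κ ω ∈ Icc (0 : ℝ) 1) {ψ : ℝ → ℝ} {d : ℝ} (hψ0 : ψ 0 = 0)
    (hψ : HasDerivWithinAt ψ d (Ici 0) 0)
    (hψi : ∀ z, Integrable (fun ω => ψ (z * κ ω)) μ) :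
    Tendsto (fun z => z⁻¹ * ∫ ω, ψ (z * κ ω) ∂μ) (𝓝[>] 0) (𝓝 (d * ∫ ω, κ ω ∂μ)) := by
  have hκi : Integrable κ μ := Integrable.of_bound hκ.aestronglyMeasurable 1 (by
    filter_upwards [hκ01] with ω hω
    rw [Real.norm_of_nonneg hω.1]; exact hω.2)
  rw [Metric.tendsto_nhds]
  intro ε hε
  set m := μ.real univ
  have hm : 0 ≤ m := measureReal_nonneg
  have h1 := (hasDerivWithinAt_iff_isLittleO.1 hψ).def (c := ε / (m + 1)) (by positivity)
  simp only [hψ0, sub_zero, smul_eq_mul] at h1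
  obtain ⟨η, hη, hηs⟩ := (mem_nhdsGE_iff_exists_Icc_subset).1 h1
  filter_upwards [Ioc_mem_nhdsGT hη] with z hz
  have e : z⁻¹ * ∫ ω, ψ (z * κ ω) ∂μ - d * ∫ ω, κ ω ∂μ
      = z⁻¹ * ∫ ω, (ψ (z * κ ω) - z * κ ω * d) ∂μ := by
    rw [integral_sub (hψi z) ((hκi.const_mul z).mul_const d), integral_mul_const,
      integral_const_mul]
    have := hz.1.ne'
    field_simp
  have h2 : ‖∫ ω, (ψ (z * κ ω) - z * κ ω * d) ∂μ‖ ≤ (ε / (m + 1) * z) * m := by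
    refine norm_integral_le_of_norm_le_const ?_
    filter_upwards [hκ01] with ω hω
    have h0 : 0 ≤ z * κ ω := mul_nonneg hz.1.le hω.1
    have hle : z * κ ω ≤ z := mul_le_of_le_one_right hz.1.le hω.2
    have h3 : ‖ψ (z * κ ω) - z * κ ω * d‖ ≤ ε / (m + 1) * ‖z * κ ω‖ :=
      hηs ⟨h0, hle.trans hz.2⟩
    refine h3.trans ?_
    rw [Real.norm_of_nonneg h0]
    gcongr
  rw [dist_eq_norm, e, norm_mul, norm_inv, Real.norm_of_nonneg hz.1.le]
  have hz0 := hz.1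
  calc _ ≤ z⁻¹ * ((ε / (m + 1) * z) * m) := by gcongr
    _ = ε * (m / (m + 1)) := by field_simp
    _ < ε * 1 := by gcongr; rw [div_lt_one (by positivity)]; linarith
    _ = ε := mul_one _

/-- If the curve `W` stays on a level set of `g` to which `f` is tangent, then the second
derivative of `g` in the direction `f x₀` vanishes. -/
theorem second_fderiv_eq_zero_of_level [CompleteSpace V] (hκ : Measurable κ)
    (hκ01 : ∀ᵐ ω ∂μ, κ ω ∈ Icc (0 : ℝ) 1) (hf : LipschitzOnWith L f (closedBall x₀ r))
    (hW : LipschitzWith C W) (hWr : ∀ z, W z ∈ closedBall x₀ r) (hδ : 0 < δ)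
    (hWeq : ∀ z ∈ Icc 0 δ, W z = x₀ + z • ∫ ω, f (W (z * κ ω)) ∂μ)
    (hm : μ.real univ ≠ 0) (hk : μ.real univ / 2 ≠ ∫ ω, κ ω ∂μ)
    (hfd : DifferentiableAt ℝ f x₀) {g : V → ℝ} (hg : ContDiffAt ℝ 2 g x₀) {c : ℝ}
    (hgW : ∀ z ∈ Ico 0 δ, g (W z) = c)
    (htan : ∀ z ∈ Ico 0 δ, fderiv ℝ g (W z) (f (W z)) = 0) :
    fderiv ℝ (fderiv ℝ g) x₀ (f x₀) (f x₀) = 0 := by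
  set m := μ.real univ
  set v := f x₀
  set B := fderiv ℝ (fderiv ℝ g) x₀
  set φ := fderiv ℝ g x₀
  have hW0 : W 0 = x₀ := by simpa using hWeq 0 ⟨le_rfl, hδ.le⟩
  have hWd := dilation_solution_hasDerivWithinAt hκ hκ01 hf hW hWr hδ hWeq
  have hB : HasFDerivAt (fderiv ℝ g) B x₀ :=
    ((hg.fderiv_right (m := 1) (by norm_num)).differentiableAt one_ne_zero).hasFDerivAt
  have hslope : Tendsto (fun z => z⁻¹ • (W z - x₀)) (𝓝[>] 0) (𝓝 (m • v)) := by
    rw [← hasDerivWithinAt_Ioi_iff_Ici, hasDerivWithinAt_iff_tendsto_slope' (by simp)] at hWd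
    refine hWd.congr fun z => ?_
    rw [slope_def_module, hW0, sub_zero]
  let ψ : ℝ → ℝ := fun s => φ (f (W s))
  have hφv : φ v = 0 := by simpa [hW0] using htan 0 ⟨le_rfl, hδ⟩
  have hψ : HasDerivWithinAt ψ (-(m * B v v)) (Ici 0) 0 := by
    have h1 : HasDerivWithinAt (fun s => fderiv ℝ g (W s)) (B (m • v)) (Ici 0) 0 :=
      HasFDerivAt.comp_hasDerivWithinAt (0 : ℝ) (by rw [hW0]; exact hB) hWd
    have h2 : HasDerivWithinAt (fun s => f (W s)) (fderiv ℝ f x₀ (m • v)) (Ici 0) 0 :=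
      HasFDerivAt.comp_hasDerivWithinAt (0 : ℝ) (by rw [hW0]; exact hfd.hasFDerivAt) hWd
    have h3 := (h1.const_sub φ).clm_apply h2
    rw [hW0] at h3
    -- By tangency this function equals `ψ`. Its first factor vanishes at `s = 0`, so the product
    -- rule loses the term with the derivative of `f`.
    have h4 : HasDerivWithinAt (fun s => (φ - fderiv ℝ g (W s)) (f (W s))) (-(m * B v v))
        (Ici 0) 0 := h3.congr_deriv (by simp [φ, v])
    refine h4.congr_of_eventuallyEq ?_ ?_
    · filter_upwards [Ico_mem_nhdsGE hδ] with s hs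
      simp [ψ, htan s hs]
    · simp [ψ, htan 0 ⟨le_rfl, hδ⟩]
  have hψi : ∀ z, Integrable (fun ω => ψ (z * κ ω)) μ := fun z =>
    φ.integrable_comp (integrable_comp_dilation hκ hf hW hWr z)
  have hlim := tendsto_inv_mul_integral_dilation hκ hκ01 (by simpa [ψ, hW0] using hφv) hψ hψi
  have hφW : ∀ᶠ z in 𝓝[>] (0 : ℝ), z⁻¹ * ∫ ω, ψ (z * κ ω) ∂μ = z⁻¹ ^ 2 * φ (W z - x₀) := by
    filter_upwards [Ioc_mem_nhdsGT hδ] with z hz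
    have e : φ (∫ ω, f (W (z * κ ω)) ∂μ) = ∫ ω, ψ (z * κ ω) ∂μ :=
      (φ.integral_comp_comm (integrable_comp_dilation hκ hf hW hWr z)).symm
    rw [hWeq z ⟨hz.1.le, hz.2⟩, add_sub_cancel_left, map_smul, e, smul_eq_mul]
    have := hz.1.ne'
    field_simp
  have h1 := hlim.congr' hφW
  have hWtend : Tendsto W (𝓝[>] 0) (𝓝 x₀) := by
    have := hW.continuous.tendsto 0
    rw [hW0] at this
    exact this.mono_left nhdsWithin_le_nhds
  have hWO : (fun z => ‖W z - x₀‖ ^ 2) =O[𝓝[>] 0] fun z : ℝ => z ^ 2 := by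
    refine IsBigO.pow (IsBigO.of_bound C ?_) 2
    refine Eventually.of_forall fun z => ?_
    have := hW.dist_le_mul z 0
    rwa [hW0, dist_eq_norm, dist_zero_right, ← norm_norm] at this
  have h2 := ((hg.taylor_two_isLittleO.comp_tendsto hWtend).trans_isBigO hWO).tendsto_div_nhds_zero
  have h3 : Tendsto (fun z => B (z⁻¹ • (W z - x₀)) (z⁻¹ • (W z - x₀))) (𝓝[>] 0)
      (𝓝 (B (m • v) (m • v))) := by
    have h : Continuous fun q => B q q := B.continuous.clm_apply continuous_id
    exact (h.tendsto _).comp hslope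
  -- Linear term, quadratic term and remainder of the Taylor formula, each divided by `z ^ 2`; their
  -- sum is `0` because `g (W z) = c`.
  have h4 := (h1.add (h3.const_mul (1 / 2))).add h2
  have h5 : Tendsto (fun _ : ℝ => (0 : ℝ)) (𝓝[>] 0)
      (𝓝 (-(m * B v v) * ∫ ω, κ ω ∂μ + 1 / 2 * B (m • v) (m • v) + 0)) := by
    refine h4.congr' ?_
    filter_upwards [Ioo_mem_nhdsGT hδ] with z hz
    have e1 := hgW z ⟨hz.1.le, hz.2⟩
    have e2 := hgW 0 ⟨le_rfl, hδ⟩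
    rw [hW0] at e2
    have := hz.1.ne'
    simp only [Function.comp, e1, e2, map_smul, smul_apply, smul_eq_mul]
    change _ + _ + (c - c - φ (W z - x₀) - 1 / 2 * B (W z - x₀) (W z - x₀)) / z ^ 2 = 0
    field_simp
    ring
  have h6 := tendsto_nhds_unique h5 tendsto_const_nhds
  simp only [map_smul, smul_apply, smul_eq_mul] at h6
  have h7 : (m * (m / 2 - ∫ ω, κ ω ∂μ)) * B v v = 0 := by linarith
  exact (mul_eq_zero.1 h7).resolve_left (mul_ne_zero hm (sub_ne_zero.2 hk))

end Expansion

/-! ### Consequences of invariance -/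

section Invariant

variable {α : ℝ} {E : Set Plane} {f : Plane → Plane} {g : Plane → ℝ} {c : ℝ} {p : Plane}

theorem fderiv_apply_eq_zero_of_isInvariant (hα0 : 0 < α) (hα1 : α < 1) (hE : IsOpen E)
    (hf : ContDiffOn ℝ 1 f E) (hg : ContDiffOn ℝ 2 g E)
    (hinv : IsInvariant α f E (levelCurve E g c)) (hp : p ∈ levelCurve E g c) :
    fderiv ℝ g p (f p) = 0 ∧ fderiv ℝ (fderiv ℝ g) p (f p) (f p) = 0 := by
  have := isFiniteMeasure_rlMeasure hα0
  have hκ : Measurable fun u : ℝ => u ^ α := by fun_prop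
  have hκ01 := rlMeasure_ae_rpow_mem hα0
  have hΓ : 0 < Real.Gamma α := Real.Gamma_pos_of_pos hα0
  have hm : (rlMeasure α).real univ ≠ 0 := by rw [rlMeasure_real_univ hα0]; positivity
  have hstay : ∀ {p : Plane} {W : ℝ → Plane} {δ : ℝ}, p ∈ levelCurve E g c → 0 < δ → W 0 = p →
      IsSolution α f E (δ ^ (1 / α)) (fun t => W (t ^ α)) →
      ∀ z ∈ Ico 0 δ, W z ∈ levelCurve E g c := fun {p W δ} hp hδ hW0 hsol z hz => by
    have h := hinv _ _ (by positivity) hsol (by simpa [Real.zero_rpow hα0.ne', hW0] using hp)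
      (z ^ (1 / α)) ⟨Real.rpow_nonneg hz.1 _, Real.rpow_lt_rpow hz.1 hz.2 (by positivity)⟩
    simpa only [← Real.rpow_mul hz.1, one_div_mul_cancel hα0.ne', Real.rpow_one] using h
  -- Needed at every point of the curve, since the second-order argument uses tangency all along the
  -- trajectory.
  have htan : ∀ p ∈ levelCurve E g c, fderiv ℝ g p (f p) = 0 := fun p hp => by
    obtain ⟨δ, hδ, C, W, L, r, -, -, hL, hW, hWr, hWeq, hsol⟩ :=
      exists_solution hα0 hα1 hE hf hp.1
    have hW0 : W 0 = p := by simpa using hWeq 0 ⟨le_rfl, hδ.le⟩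
    have hWd := dilation_solution_hasDerivWithinAt hκ hκ01 hL hW hWr hδ hWeq
    have hgp : HasFDerivAt g (fderiv ℝ g p) (W 0) := by
      rw [hW0]
      exact ((hg.contDiffAt (hE.mem_nhds hp.1)).differentiableAt two_ne_zero).hasFDerivAt
    have h1 := hgp.comp_hasDerivWithinAt (0 : ℝ) hWd
    have h2 : HasDerivWithinAt (g ∘ W) 0 (Ici 0) 0 := by
      refine (hasDerivWithinAt_const (0 : ℝ) (Ici 0) c).congr_of_eventuallyEq ?_ ?_
      · filter_upwards [Ico_mem_nhdsGE hδ] with z hz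
        exact (hstay hp hδ hW0 hsol z hz).2
      · simp [hW0, hp.2]
    have h3 := (uniqueDiffWithinAt_Ici (0 : ℝ)).eq_deriv _ h1 h2
    rw [map_smul, smul_eq_mul] at h3
    exact (mul_eq_zero.1 h3).resolve_left hm
  refine ⟨htan p hp, ?_⟩
  obtain ⟨δ, hδ, C, W, L, r, -, -, hL, hW, hWr, hWeq, hsol⟩ :=
    exists_solution hα0 hα1 hE hf hp.1
  have hW0 : W 0 = p := by simpa using hWeq 0 ⟨le_rfl, hδ.le⟩
  have hs := hstay hp hδ hW0 hsol
  exact second_fderiv_eq_zero_of_level hκ hκ01 hL hW hWr hδ hWeq hm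
    (half_rlMeasure_lt_integral_rpow hα0 hα1).ne
    ((hf.contDiffAt (hE.mem_nhds hp.1)).differentiableAt one_ne_zero)
    (hg.contDiffAt (hE.mem_nhds hp.1)) (fun z hz => (hs z hz).2) fun z hz => htan _ (hs z hz)

end Invariant

/-! ### Tangent directions and curvature in the plane -/

section PlaneGeometry

/-- The quadratic form in the numerator of the curvature: the second derivative of `g` in the
direction tangent to the level curve. -/
noncomputable def curvatureForm (g : Plane → ℝ) (p : Plane) : ℝ :=
  partialD 0 (partialD 0 g) p * partialD 1 g p ^ 2
    - 2 * partialD 0 (partialD 1 g) p * partialD 0 g p * partialD 1 g p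
    + partialD 1 (partialD 1 g) p * partialD 0 g p ^ 2

theorem plane_eq (x : Plane) :
    x = x 0 • EuclideanSpace.single 0 1 + x 1 • EuclideanSpace.single 1 1 := by
  ext i; fin_cases i <;> simp

theorem plane_functional_apply (M : Plane →L[ℝ] ℝ) (x : Plane) :
    M x = x 0 * M (EuclideanSpace.single 0 1) + x 1 * M (EuclideanSpace.single 1 1) := by
  conv_lhs => rw [plane_eq x]
  simp

theorem plane_functional_ne_zero {M : Plane →L[ℝ] ℝ} (hM : M ≠ 0) :
    0 < M (EuclideanSpace.single 0 1) ^ 2 + M (EuclideanSpace.single 1 1) ^ 2 := by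
  by_contra! h
  refine hM (ContinuousLinearMap.ext fun x => ?_)
  have h0 : M (EuclideanSpace.single 0 1) = 0 := by
    nlinarith [sq_nonneg (M (EuclideanSpace.single 0 1)), sq_nonneg (M (EuclideanSpace.single 1 1))]
  have h1 : M (EuclideanSpace.single 1 1) = 0 := by
    nlinarith [sq_nonneg (M (EuclideanSpace.single 0 1)), sq_nonneg (M (EuclideanSpace.single 1 1))]
  rw [plane_functional_apply, h0, h1]
  simp

theorem partialD_partialD {g : Plane → ℝ} {p : Plane} (hg : ContDiffAt ℝ 2 g p) (i j : Fin 2) :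
    partialD i (partialD j g) p = fderiv ℝ (fderiv ℝ g) p (EuclideanSpace.single i 1)
      (EuclideanSpace.single j 1) := by
  have hB : HasFDerivAt (fderiv ℝ g) (fderiv ℝ (fderiv ℝ g) p) p :=
    ((hg.fderiv_right (m := 1) (by norm_num)).differentiableAt one_ne_zero).hasFDerivAt
  have h := hB.clm_apply (hasFDerivAt_const (EuclideanSpace.single j (1 : ℝ) : Plane) p)
  have e : fderiv ℝ (partialD j g) p = _ := h.fderiv
  rw [partialD, e]
  simp

theorem second_fderiv_tangent {g : Plane → ℝ} {p v : Plane} (hg : ContDiffAt ℝ 2 g p)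
    (hφ : fderiv ℝ g p ≠ 0) (hv : fderiv ℝ g p v = 0) :
    ∃ l : ℝ, (v ≠ 0 → l ≠ 0) ∧
      fderiv ℝ (fderiv ℝ g) p v v = l ^ 2 * curvatureForm g p := by
  set φ := fderiv ℝ g p
  set B := fderiv ℝ (fderiv ℝ g) p
  set e₀ : Plane := EuclideanSpace.single 0 1
  set e₁ : Plane := EuclideanSpace.single 1 1
  have hsymm : ∀ v w, B v w = B w v := hg.isSymmSndFDerivAt (by simp)
  have hpos : 0 < φ e₀ ^ 2 + φ e₁ ^ 2 := plane_functional_ne_zero hφ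
  have hv' : v 0 * φ e₀ + v 1 * φ e₁ = 0 := by rw [← plane_functional_apply]; exact hv
  -- The coordinate of `v` along the tangent vector `(-g_y, g_x)`, obtained by orthogonal
  -- projection.
  set l := (φ e₀ * v 1 - φ e₁ * v 0) / (φ e₀ ^ 2 + φ e₁ ^ 2)
  have h0 : v 0 = l * -φ e₁ := by
    simp only [l]; field_simp; linear_combination φ e₀ * hv'
  have h1 : v 1 = l * φ e₀ := by
    simp only [l]; field_simp; linear_combination φ e₁ * hv'
  refine ⟨l, fun hv0 hl => hv0 ?_, ?_⟩
  · rw [plane_eq v, h0, h1, hl]; simp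
  · rw [curvatureForm, partialD_partialD hg, partialD_partialD hg, partialD_partialD hg]
    have e : B v v = v 0 ^ 2 * B e₀ e₀ + 2 * (v 0 * v 1) * B e₀ e₁ + v 1 ^ 2 * B e₁ e₁ := by
      have hv2 : v = v 0 • e₀ + v 1 • e₁ := plane_eq v
      rw [hv2]
      simp only [map_add, map_smul, add_apply, smul_apply, smul_eq_mul, hsymm e₁ e₀]
      simp [e₀, e₁]
      ring
    rw [e, h0, h1]
    simp only [partialD]
    ring

theorem curvatureForm_eq_zero {α : ℝ} {E : Set Plane} {f : Plane → Plane} {g : Plane → ℝ} {c : ℝ}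
    {p : Plane} (hα0 : 0 < α) (hα1 : α < 1) (hE : IsOpen E)
    (hf : ContDiffOn ℝ 1 f E) (hg : ContDiffOn ℝ 2 g E)
    (hinv : IsInvariant α f E (levelCurve E g c)) (hp : p ∈ levelCurve E g c)
    (hφ : fderiv ℝ g p ≠ 0) (hfp : f p ≠ 0) : curvatureForm g p = 0 := by
  obtain ⟨h1, h2⟩ := fderiv_apply_eq_zero_of_isInvariant hα0 hα1 hE hf hg hinv hp
  obtain ⟨l, hl, e⟩ := second_fderiv_tangent (hg.contDiffAt (hE.mem_nhds hp.1)) hφ h1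
  rw [h2] at e
  exact (mul_eq_zero.1 e.symm).resolve_left (pow_ne_zero 2 (hl hfp))

/-- A common nonzero kernel vector forces the determinant of the two functionals to vanish; the
product form avoids division. -/
theorem plane_functionals_parallel {M N : Plane →L[ℝ] ℝ} {y : Plane} (hy : y ≠ 0) (hM : M y = 0)
    (hN : N y = 0) (v w : Plane) : N v * M w = M v * N w := by
  rw [plane_functional_apply M] at hM
  rw [plane_functional_apply N] at hN
  rw [plane_functional_apply M v, plane_functional_apply M w, plane_functional_apply N v,
    plane_functional_apply N w]
  set M0 := M (EuclideanSpace.single 0 1)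
  set M1 := M (EuclideanSpace.single 1 1)
  set N0 := N (EuclideanSpace.single 0 1)
  set N1 := N (EuclideanSpace.single 1 1)
  have h0 : y 0 * (M0 * N1 - M1 * N0) = 0 := by linear_combination N1 * hM - M1 * hN
  have h1 : y 1 * (M0 * N1 - M1 * N0) = 0 := by linear_combination M0 * hN - N0 * hM
  have h : M0 * N1 - M1 * N0 = 0 := by
    by_contra hne
    refine hy ?_
    rw [plane_eq y, (mul_eq_zero.1 h0).resolve_right hne, (mul_eq_zero.1 h1).resolve_right hne]
    simp
  linear_combination (v 1 * w 0 - v 0 * w 1) * h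

end PlaneGeometry

/-! ### Flat connected level curves are straight -/

/-- Near a regular point, a level curve of a `C²` function is a `C²` curve, parametrized by a
linear coordinate. -/
theorem exists_levelCurve_param {E : Set Plane} (hE : IsOpen E) {g : Plane → ℝ}
    (hg : ContDiffOn ℝ 2 g E) {c : ℝ} {p : Plane} (hp : p ∈ levelCurve E g c)
    (hφ : fderiv ℝ g p ≠ 0) :
    ∃ (τ : Plane →L[ℝ] ℝ) (γ : ℝ → Plane) (ε : ℝ), 0 < ε ∧ γ 0 = p ∧
      (∀ s ∈ ball (0 : ℝ) ε, DifferentiableAt ℝ γ s ∧ γ s ∈ levelCurve E g c ∧ τ (γ s - p) = s) ∧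
      ∀ᶠ q in 𝓝[levelCurve E g c] p, τ (q - p) ∈ ball (0 : ℝ) ε ∧ γ (τ (q - p)) = q := by
  set φ := fderiv ℝ g p
  set a := φ (EuclideanSpace.single 0 1)
  set b := φ (EuclideanSpace.single 1 1)
  have hpos : 0 < a ^ 2 + b ^ 2 := plane_functional_ne_zero hφ
  -- Pairing with the tangent vector `(-b, a)`; together with `φ` it is an isomorphism, so `(τ (q -
  -- p), g q)` is a local chart.
  let τ : Plane →L[ℝ] ℝ := a • EuclideanSpace.proj 1 - b • EuclideanSpace.proj 0
  have hτ : ∀ x, τ x = a * x 1 - b * x 0 := fun x => by simp [τ]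
  have hgp := hg.contDiffAt (hE.mem_nhds hp.1)
  let Ψ : Plane → ℝ × ℝ := fun q => (τ (q - p), g q)
  have hinj : Function.Injective (τ.prod φ : Plane →L[ℝ] ℝ × ℝ) := by
    rw [injective_iff_map_eq_zero]
    intro x hx
    have h1 : τ x = 0 := congrArg Prod.fst hx
    have h2 : φ x = 0 := congrArg Prod.snd hx
    rw [hτ] at h1
    have h2' : x 0 * a + x 1 * b = 0 := by rw [← h2, plane_functional_apply φ x]
    have h3 : (a ^ 2 + b ^ 2) * x 0 = 0 := by linear_combination a * h2' - b * h1
    have h4 : (a ^ 2 + b ^ 2) * x 1 = 0 := by linear_combination b * h2' + a * h1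
    rw [plane_eq x, (mul_eq_zero.1 h3).resolve_left hpos.ne',
      (mul_eq_zero.1 h4).resolve_left hpos.ne']
    simp
  let A : Plane ≃L[ℝ] ℝ × ℝ := (LinearEquiv.ofInjectiveOfFinrankEq
    (τ.prod φ : Plane →L[ℝ] ℝ × ℝ).toLinearMap hinj (by simp)).toContinuousLinearEquiv
  have hA : (A : Plane →L[ℝ] ℝ × ℝ) = τ.prod φ := by ext x <;> rfl
  have hΨ : ContDiffAt ℝ 2 Ψ p :=
    (τ.contDiff.contDiffAt.comp p (contDiffAt_id.sub contDiffAt_const)).prodMk hgp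
  have hΨ' : HasFDerivAt Ψ (A : Plane →L[ℝ] ℝ × ℝ) p := by
    rw [hA]
    have h1 : HasFDerivAt (fun q => τ (q - p)) τ p := by
      exact (τ.hasFDerivAt.comp p ((hasFDerivAt_id p).sub_const p)).congr_fderiv (by ext; simp)
    exact h1.prodMk (hgp.differentiableAt two_ne_zero).hasFDerivAt
  let e := hΨ.toOpenPartialHomeomorph Ψ hΨ' two_ne_zero
  have he : ∀ q, e q = Ψ q := fun q => rfl
  have hps : p ∈ e.source := hΨ.mem_toOpenPartialHomeomorph_source hΨ' two_ne_zero
  have hΨp : Ψ p = (0, c) := by simp [Ψ, hp.2]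
  have hpt : ((0, c) : ℝ × ℝ) ∈ e.target := by rw [← hΨp]; exact e.map_source hps
  have hsymm0 : e.symm (0, c) = p := by rw [← hΨp]; exact e.left_inv hps
  have hesymm : ContDiffAt ℝ 2 e.symm ((0, c) : ℝ × ℝ) :=
    e.contDiffAt_symm hpt (by rw [hsymm0]; exact hΨ') (by rw [hsymm0]; exact hΨ)
  let ι : ℝ → ℝ × ℝ := fun s => (s, c)
  have hι : Continuous ι := by fun_prop
  have hev : ∀ᶠ s in 𝓝 (0 : ℝ), ContDiffAt ℝ 2 e.symm (ι s) ∧ ι s ∈ e.target ∧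
      e.symm (ι s) ∈ E := by
    have h1 := (hι.tendsto 0).eventually (hesymm.eventually (by simp))
    have h2 := (hι.tendsto 0).eventually (e.open_target.mem_nhds hpt)
    have h3 : ∀ᶠ y in 𝓝 (ι 0), e.symm y ∈ E :=
      hesymm.continuousAt.eventually (by rw [hsymm0]; exact hE.mem_nhds hp.1)
    exact h1.and (h2.and ((hι.tendsto 0).eventually h3))
  obtain ⟨ε, hε, hball⟩ := Metric.eventually_nhds_iff_ball.1 hev
  refine ⟨τ, fun s => e.symm (ι s), ε, hε, hsymm0, fun s hs => ?_, ?_⟩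
  · obtain ⟨h1, h2, h3⟩ := hball s hs
    have h4 : Ψ (e.symm (ι s)) = (s, c) := e.right_inv h2
    exact ⟨(h1.differentiableAt two_ne_zero).comp s (by fun_prop),
      ⟨h3, congrArg Prod.snd h4⟩, congrArg Prod.fst h4⟩
  · have h1 : ∀ᶠ q in 𝓝 p, τ (q - p) ∈ ball (0 : ℝ) ε := by
      have : Continuous fun q => τ (q - p) := by fun_prop
      exact (this.tendsto p).eventually (by rw [sub_self, map_zero]; exact ball_mem_nhds _ hε)
    filter_upwards [nhdsWithin_le_nhds h1, nhdsWithin_le_nhds (e.open_source.mem_nhds hps),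
      self_mem_nhdsWithin] with q hq1 hq2 hq3
    refine ⟨hq1, ?_⟩
    have : ι (τ (q - p)) = e q := by rw [he]; simp [ι, Ψ, hq3.2]
    simp only [this]
    exact e.left_inv hq2

/-- A regular level curve with vanishing curvature has a locally constant tangent line. -/
theorem eventually_tangent_line_eq {E : Set Plane} (hE : IsOpen E) {g : Plane → ℝ}
    (hg : ContDiffOn ℝ 2 g E) {c : ℝ} (hreg : ∀ p ∈ levelCurve E g c, fderiv ℝ g p ≠ 0)
    (hflat : ∀ p ∈ levelCurve E g c, curvatureForm g p = 0) {p : Plane}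
    (hp : p ∈ levelCurve E g c) :
    ∀ᶠ q in 𝓝[levelCurve E g c] p,
      ∀ x, fderiv ℝ g q (x - q) = 0 ↔ fderiv ℝ g p (x - p) = 0 := by
  obtain ⟨τ, γ, ε₁, hε₁, hγ0, hγ, hnear⟩ := exists_levelCurve_param hE hg hp (hreg p hp)
  set φ := fderiv ℝ g p with hφ
  set e₀ : Plane := EuclideanSpace.single 0 1
  set e₁ : Plane := EuclideanSpace.single 1 1
  have hpos : 0 < φ e₀ ^ 2 + φ e₁ ^ 2 := plane_functional_ne_zero (hreg p hp)
  -- `w` is tangent and `n` normal to the curve at `p`.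
  let w : Plane := -φ e₁ • e₀ + φ e₀ • e₁
  let n : Plane := φ e₀ • e₀ + φ e₁ • e₁
  have hφw : φ w = 0 := by simp [w]; ring
  have hφn : φ n ≠ 0 := by
    have : φ n = φ e₀ ^ 2 + φ e₁ ^ 2 := by simp [n]; ring
    rw [this]; exact hpos.ne'
  have hw : w ≠ 0 := fun h => by
    have h0 : φ e₁ = 0 := by simpa [w, e₀, e₁] using congrArg (fun x : Plane => x 0) h
    have h1 : φ e₀ = 0 := by simpa [w, e₀, e₁] using congrArg (fun x : Plane => x 1) h
    rw [h0, h1] at hpos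
    simp at hpos
  have hDg : ∀ q ∈ E, HasFDerivAt (fderiv ℝ g) (fderiv ℝ (fderiv ℝ g) q) q := fun q hq =>
    (((hg.contDiffAt (hE.mem_nhds hq)).fderiv_right (m := 1) (by norm_num)).differentiableAt
      one_ne_zero).hasFDerivAt
  have hcont : ContinuousAt (fun s => fderiv ℝ g (γ s) n) 0 := by
    have h1 : ContinuousAt (fderiv ℝ g) (γ 0) := by
      rw [hγ0]; exact (hDg p hp.1).continuousAt
    have h2 : ContinuousAt (fun s => fderiv ℝ g (γ s)) 0 :=
      ContinuousAt.comp (f := γ) (x := (0 : ℝ)) h1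
        (hγ 0 (mem_ball_self hε₁)).1.continuousAt
    exact h2.clm_apply continuousAt_const
  have hne := hcont.eventually_ne (y := 0) (by rw [hγ0]; exact hφn)
  obtain ⟨ε, hε, hball⟩ := Metric.eventually_nhds_iff_ball.1
    (hne.and (ball_mem_nhds (0 : ℝ) hε₁))
  have h0mem : (0 : ℝ) ∈ ball (0 : ℝ) ε := mem_ball_self hε
  have hγd : ∀ s ∈ ball (0 : ℝ) ε, HasDerivAt γ (deriv γ s) s := fun s hs =>
    (hγ s (hball s hs).2).1.hasDerivAt
  have htan : ∀ s ∈ ball (0 : ℝ) ε, fderiv ℝ g (γ s) (deriv γ s) = 0 := fun s hs => by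
    have hmem := (hγ s (hball s hs).2).2.1
    have h1 := ((hg.contDiffAt (hE.mem_nhds hmem.1)).differentiableAt
      two_ne_zero).hasFDerivAt.comp_hasDerivAt s (hγd s hs)
    have h2 : HasDerivAt (g ∘ γ) 0 s := by
      refine (hasDerivAt_const s c).congr_of_eventuallyEq ?_
      filter_upwards [isOpen_ball.mem_nhds hs] with s' hs'
      exact (hγ s' (hball s' hs').2).2.1.2
    exact h1.unique h2
  have hγ'0 : ∀ s ∈ ball (0 : ℝ) ε, deriv γ s ≠ 0 := fun s hs h => by
    have h1 := τ.hasFDerivAt.comp_hasDerivAt s ((hγd s hs).sub_const p)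
    have h2 : HasDerivAt (fun s => τ (γ s - p)) 1 s := by
      refine (hasDerivAt_id s).congr_of_eventuallyEq ?_
      filter_upwards [isOpen_ball.mem_nhds hs] with s' hs'
      exact (hγ s' (hball s' hs').2).2.2
    have h3 := h1.unique h2
    simp [h] at h3
  have happ : ∀ s ∈ ball (0 : ℝ) ε, ∀ v, HasDerivAt (fun s => fderiv ℝ g (γ s) v)
      (fderiv ℝ (fderiv ℝ g) (γ s) (deriv γ s) v) s := fun s hs v => by
    have h1 := (hDg _ (hγ s (hball s hs).2).2.1.1).comp_hasDerivAt s (hγd s hs)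
    simpa using h1.clm_apply (hasDerivAt_const s v)
  have hMw : ∀ s ∈ ball (0 : ℝ) ε, fderiv ℝ g (γ s) w = 0 := fun s hs => by
    -- This ratio records the direction of the gradient. By flatness `Dg` and its derivative along
    -- `γ` both annihilate `γ'`, hence are parallel, so the quotient rule gives `u' = 0`.
    let u : ℝ → ℝ := fun s => fderiv ℝ g (γ s) w / fderiv ℝ g (γ s) n
    have hu : ∀ s ∈ ball (0 : ℝ) ε, HasDerivAt u 0 s := fun s hs => by
      refine ((happ s hs w).div (happ s hs n) (hball s hs).1).congr_deriv ?_
      have hmem := (hγ s (hball s hs).2).2.1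
      obtain ⟨l, -, hl⟩ := second_fderiv_tangent (hg.contDiffAt (hE.mem_nhds hmem.1))
        (hreg _ hmem) (htan s hs)
      rw [hflat _ hmem, mul_zero] at hl
      rw [plane_functionals_parallel (hγ'0 s hs) (htan s hs) hl w n, sub_self, zero_div]
    have h := isOpen_ball.is_const_of_deriv_eq_zero (convex_ball (0 : ℝ) ε).isPreconnected
      (fun s hs => (hu s hs).differentiableAt.differentiableWithinAt)
      (fun s hs => (hu s hs).deriv) hs h0mem
    have h0 : u 0 = 0 := by simp only [u]; rw [hγ0, ← hφ, hφw, zero_div]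
    rw [h0] at h
    exact (div_eq_zero_iff.1 h).resolve_right (hball s hs).1
  -- `Dg(γ s)` and `φ` both annihilate `w`, so they are parallel and `φ` annihilates `γ'`.
  have hline : ∀ s ∈ ball (0 : ℝ) ε, φ (γ s - p) = 0 := fun s hs => by
    have hd : ∀ s ∈ ball (0 : ℝ) ε, HasDerivAt (fun s => φ (γ s - p)) 0 s := fun s hs => by
      refine (φ.hasFDerivAt.comp_hasDerivAt s ((hγd s hs).sub_const p)).congr_deriv ?_
      have h := plane_functionals_parallel hw (hMw s hs) hφw (deriv γ s) n
      rw [htan s hs, zero_mul] at h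
      exact (mul_eq_zero.1 h).resolve_right (hball s hs).1
    have h := isOpen_ball.is_const_of_deriv_eq_zero (convex_ball (0 : ℝ) ε).isPreconnected
      (fun s hs => (hd s hs).differentiableAt.differentiableWithinAt)
      (fun s hs => (hd s hs).deriv) hs h0mem
    simpa [hγ0] using h
  have hsmall : ∀ᶠ q in 𝓝[levelCurve E g c] p, τ (q - p) ∈ ball (0 : ℝ) ε := by
    have : Continuous fun q => τ (q - p) := by fun_prop
    exact nhdsWithin_le_nhds ((this.tendsto p).eventually
      (by rw [sub_self, map_zero]; exact ball_mem_nhds _ hε))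
  filter_upwards [hnear, hsmall] with q hq hqε x
  have h1 := hline _ hqε
  have h2 := hMw _ hqε
  have h3 := (hball _ hqε).1
  rw [hq.2] at h1 h2 h3
  have h4 := plane_functionals_parallel hw h2 hφw (x - q) n
  have h5 : φ (x - p) = φ (x - q) := by
    rw [show x - p = (x - q) + (q - p) by abel, map_add, h1, add_zero]
  rw [h5]
  constructor
  · intro h
    rw [h, zero_mul] at h4
    exact (mul_eq_zero.1 h4).resolve_right h3
  · intro h
    rw [h, zero_mul] at h4
    exact (mul_eq_zero.1 h4.symm).resolve_right hφn

/-- Connectedness makes the locally constant tangent line global; each point lies on its own tangent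
line, hence on that of a fixed `p`. -/
theorem liesOnLine_of_curvatureForm_eq_zero {E : Set Plane} (hE : IsOpen E) {g : Plane → ℝ}
    (hg : ContDiffOn ℝ 2 g E) {c : ℝ} (hreg : ∀ p ∈ levelCurve E g c, fderiv ℝ g p ≠ 0)
    (hconn : IsConnected (levelCurve E g c))
    (hflat : ∀ p ∈ levelCurve E g c, curvatureForm g p = 0) : LiesOnLine (levelCurve E g c) := by
  obtain ⟨p, hp⟩ := hconn.nonempty
  have hall : ∀ q ∈ levelCurve E g c,
      ∀ x, fderiv ℝ g q (x - q) = 0 ↔ fderiv ℝ g p (x - p) = 0 := fun q hq =>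
    hconn.isPreconnected.induction₂
      (fun p q => ∀ x, fderiv ℝ g q (x - q) = 0 ↔ fderiv ℝ g p (x - p) = 0)
      (fun p hp => eventually_tangent_line_eq hE hg hreg hflat hp)
      (fun _ _ _ _ _ _ h1 h2 x => (h2 x).trans (h1 x)) (fun _ _ _ _ h x => (h x).symm) hp hq
  set φ := fderiv ℝ g p
  have hpos := plane_functional_ne_zero (hreg p hp)
  refine ⟨φ (EuclideanSpace.single 0 1), φ (EuclideanSpace.single 1 1), φ p, ?_, fun q hq => ?_⟩
  · by_contra! h
    rw [h.1, h.2] at hpos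
    simp at hpos
  · have h : φ (q - p) = 0 := (hall q hq q).1 (by simp)
    rw [map_sub, sub_eq_zero] at h
    rw [← h, plane_functional_apply φ q]
    ring

theorem continuousOn_curvatureForm {E : Set Plane} (hE : IsOpen E) {g : Plane → ℝ}
    (hg : ContDiffOn ℝ 2 g E) : ContinuousOn (curvatureForm g) E := by
  have h1 : ∀ j, ContDiffOn ℝ 1 (partialD j g) E := fun j =>
    (hg.fderiv_of_isOpen hE (m := 1) (by norm_num)).clm_apply contDiffOn_const
  have h2 : ∀ i j, ContinuousOn (partialD i (partialD j g)) E := fun i j =>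
    ((h1 j).continuousOn_fderiv_of_isOpen hE le_rfl).clm_apply continuousOn_const
  unfold curvatureForm
  have := fun j => (h1 j).continuousOn
  fun_prop

theorem curvatureForm_eq_zero_of_dense {α : ℝ} {E : Set Plane} {f : Plane → Plane}
    {g : Plane → ℝ} {c : ℝ} (hα0 : 0 < α) (hα1 : α < 1) (hE : IsOpen E)
    (hf : ContDiffOn ℝ 1 f E) (hg : ContDiffOn ℝ 2 g E)
    (hreg : ∀ p ∈ levelCurve E g c, fderiv ℝ g p ≠ 0)
    (hdense : levelCurve E g c ⊆ closure {p | p ∈ levelCurve E g c ∧ f p ≠ 0})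
    (hinv : IsInvariant α f E (levelCurve E g c)) :
    ∀ p ∈ levelCurve E g c, curvatureForm g p = 0 := by
  intro p hp
  set D := {p | p ∈ levelCurve E g c ∧ f p ≠ 0}
  have hcont := ((continuousOn_curvatureForm hE hg).continuousAt
    (hE.mem_nhds hp.1)).continuousWithinAt (s := D)
  have : (𝓝[D] p).NeBot := mem_closure_iff_nhdsWithin_neBot.1 (hdense hp)
  refine tendsto_nhds_unique (hcont.tendsto.congr' ?_) tendsto_const_nhds
  filter_upwards [self_mem_nhdsWithin] with q hq
  exact curvatureForm_eq_zero hα0 hα1 hE hf hg hinv hq.1 (hreg q hq.1) hq.2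

end FracDyn

end

open FracDyn in
theorem mainTheorem2 (α : ℝ) (hα0 : 0 < α) (hα1 : α < 1)
    (E : Set Plane) (hE : IsOpen E)
    (f : Plane → Plane) (hf : ContDiffOn ℝ 1 f E)
    (h0E : (0 : Plane) ∈ E) (hf0 : f 0 = 0)
    (g : Plane → ℝ) (hg : ContDiffOn ℝ 2 g E) (c : ℝ)
    (hreg : ∀ p ∈ levelCurve E g c, fderiv ℝ g p ≠ 0) :
    ((∃ p ∈ levelCurve E g c, f p ≠ 0 ∧ 0 < curvature g p) →
      ¬ IsInvariant α f E (levelCurve E g c)) ∧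
    (IsConnected (levelCurve E g c) →
      ¬ LiesOnLine (levelCurve E g c) →
      levelCurve E g c ⊆ closure {p | p ∈ levelCurve E g c ∧ f p ≠ 0} →
      ¬ IsInvariant α f E (levelCurve E g c)) := by
  refine ⟨?_, fun hconn hline hdense hinv => hline ?_⟩
  · rintro ⟨p, hp, hfp, hcurv⟩ hinv
    have h := curvatureForm_eq_zero hα0 hα1 hE hf hg hinv hp (hreg p hp) hfp
    have : curvature g p = 0 := by
      rw [curvature, ← curvatureForm, h, abs_zero, zero_div]
    exact hcurv.ne' this
  · exact liesOnLine_of_curvatureForm_eq_zero hE hg hreg hconn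
      (curvatureForm_eq_zero_of_dense hα0 hα1 hE hf hg hreg hdense hinv)
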